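/- Let $\kappa>0$, $q=e^{-\kappa}\in\,]0,1[$ and $[x]=(q^x-q^{-x})/(q-q^{-1})$. *Hopf algebras.* $U_q(\mathfrak{su}(2))$ is generated by $q^{\pm J_z},J_\pm$ with $q^{\pm J_z}q^{\mp J_z}=1$, $q^{J_z}J_\pm q^{-J_z}=q^{\pm1}J_\pm$, $[J_+,J_-]=\frac{q^{2J_z}-q^{-2J_z}}{q-q^{-1}}$, $\Delta(q^{\pm J_z})=q^{\pm J_z}\otimes q^{\pm J_z}$, $\Delta(J_\pm)=q^{-J_z}\otimes J_\pm+J_\pm\otimes q^{J_z}$, $S(q^{\pm J_z})=q^{\mp J_z}$, $S(J_\pm)=-q^{\pm1}J_\pm$. For $I\in\mathbb N/2$ let $\pi_I$ be its $(2I+1)$-dimensional irreducible representation on $V_I$ with basis $e^I_m$ ($m=-I,\dots,I$), $q^{J_z}e^I_m=q^me^I_m$, $J_\pm e^I_m=([I\mp m][I\pm m+1])^{1/2}e^I_{m\pm1}$, and let $\left(\begin{smallmatrix}n&p\\I&J\end{smallmatrix}\Big|\begin{smallmatrix}K\\m\end{smallmatrix}\right)=\left(\begin{smallmatrix}m\\K\end{smallmatrix}\Big|\begin{smallmatrix}I&J\\n&p\end{smallmatrix}\right)$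 be the (real, orthonormal) Clebsch–Gordan coefficients with the Condon–Shortley phases. $F_q(\mathrm{SU}(2))$ is the dual Hopf algebra spanned by the matrix elements $u^{\ m}_{I\ n}=\pi_I(\cdot)^m_{\ n}$. The quantum Lorentz group $D=D(U_q(\mathfrak{su}(2)))=U_q(\mathfrak{su}(2))\,\hat\otimes\,F_q(\mathrm{SU}(2))^{op}$ is the quantum double ($op$ = opposite coproduct), with $f\cdot y=\sum\langle S^{-1}(y_{(1)}),f_{(3)}\rangle\langle y_{(3)},f_{(1)}\rangle\, y_{(2)}f_{(2)}$ for $y\in U_q(\mathfrak{su}(2))$, $f\in F_q(\mathrm{SU}(2))$. *Principal representations.* Let $\alpha=(n,p)$ with $n\in\mathbb Z/2$ and $p\in[0,\frac{4\pi}{\kappa}[$ (or $n=0$, $p\in[0,\frac{2\pi}\kappa]$). $V_\alpha=\bigoplus_{I=|n|}^\infty V_I$ has the basis $e^I_m$, $I\in|n|+\mathbb N$; $U_q(\mathfrak{su}(2))$ acts on each $V_I$ by $\pi_I$ and $$\pi_\alpha(u^{\ r}_{J\ r'})\,e^L_k=\sum_{M,N,m,k'} e^N_{k'}\left(\begin{smallmatrix}k'&r\\N&J\end{smallmatrix}\Big|\begin{smallmatrix}M\\m\end{smallmatrix}\right)\left(\begin{smallmatrix}m\\M\end{smallmatrix}\Big|\begin{smallmatrix}J&L\\r'&k\end{smallmatrix}\right)\Lambda^{JM}_{NL}(\alpha).$$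 Here $\Lambda^{JM}_{NL}(\alpha)$ is the analytic continuation to $2A+1=\frac{ip}2+n$, $2B+1=\frac{ip}2-n$ of $$(-1)^{N+J-M}\sum_{x=A-J}^{A+J}q^{\frac{c_N+c_L}2-c_M-c_J+2c_x-2c_A}\,[2x+1]\,\big([2N+1][2L+1]\big)^{1/2}\begin{Bmatrix}A&B&N\\M&J&x\end{Bmatrix}_q\begin{Bmatrix}A&B&L\\M&J&x\end{Bmatrix}_q,\qquad c_I=I(I+1),$$ where, with $s=\frac{ip}2$, the product of the triangle coefficients of $(A,B,N)$ and $(A,B,L)$ is continued to $$\frac{(-i)^{N+L-2|n|}\,([N+n]!\,[N-n]!\,[L+n]!\,[L-n]!)^{1/2}}{\prod_{|k|\le|n|}[s+k]\;\prod_{|n|<k\le N}|[s+k]|\;\prod_{|n|<k\le L}|[s+k]|},$$ and removable singularities in $p$ are filled by limits. *Statement.* Let $V_\alpha^*=\bigoplus_{I\ge|n|}V_I^*$, with dual basis $e^{Ia}$, carry the dual action $(a\cdot f)(v)=f(\pi_\alpha(S(a))v)$, and let $\epsilon_{I\,mn}=e^{-i\pi(I+m)}q^{I(I+1)}q^{-m}\delta_{m,-n}$.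 For every constant $c_\alpha\ne0$ the linear map $\phi^\alpha:V_\alpha\to V_\alpha^*$ given by $$\phi^\alpha(e^I_a)=\sum_{J,b}\phi^\alpha_{IaJb}\,e^{Jb},\qquad \phi^\alpha_{IaJb}=c_\alpha\,q^{-I(I+1)}\,\delta_{IJ}\,\epsilon_{I\,ba},$$ is well defined and is a bijective intertwiner, and the bilinear form $\beta_\alpha(v,w)=\phi^\alpha(w)(v)$ on $V_\alpha$ satisfies $$\beta_\alpha(v,\pi_\alpha(a)w)=\beta_\alpha(\pi_\alpha(S(a))v,w)\qquad\text{for all }a\in D,\ v,w\in V_\alpha.$$ -/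

import Mathlib

open scoped TensorProduct

noncomputable section

namespace QLorentz

/-!
The deformation parameter is `q = exp (-κ)` with `κ` real.  Spins `I ∈ ℕ/2` are encoded by the
natural number `2I`, and a magnetic number `m ∈ {-I, ..., I}` by `a = I + m ∈ {0, ..., 2I}`.
-/

/-! ### q-numbers -/

/-- `q ^ x` for real `x`, where `q = exp (-κ)`. -/
def qpow (κ x : ℝ) : ℝ := Real.exp (-κ * x)

/-- `q ^ x` for complex `x`. -/
def qpowC (κ : ℝ) (x : ℂ) : ℂ := Complex.exp (-(κ : ℂ) * x)

/-- The q-number `[x] = (q ^ x - q ^ (-x)) / (q - q⁻¹)` for real `x`. -/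
def qnum (κ x : ℝ) : ℝ := (qpow κ x - qpow κ (-x)) / (qpow κ 1 - qpow κ (-1))

/-- The q-number `[x]` for complex `x`. -/
def qnumC (κ : ℝ) (x : ℂ) : ℂ := (qpowC κ x - qpowC κ (-x)) / (qpowC κ 1 - qpowC κ (-1))

/-- The q-factorial `[n]!`. -/
def qfact (κ : ℝ) (n : ℕ) : ℝ := ∏ i ∈ Finset.range n, qnum κ ((i : ℝ) + 1)

/-- `1 / [z]!`, with the usual convention that it vanishes for negative integers `z`. -/
def qinvFact (κ : ℝ) (z : ℤ) : ℝ := if z < 0 then 0 else (qfact κ z.toNat)⁻¹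

/-! ### The Hopf algebra `U_q(su(2))` -/

/-- The generators `q^{J_z}`, `q^{-J_z}`, `J_+`, `J_-`. -/
inductive UqGen : Type
  | K | Kinv | Jp | Jm

/-- The defining relations of `U_q(su(2))`. -/
inductive UqRel (κ : ℝ) : FreeAlgebra ℂ UqGen → FreeAlgebra ℂ UqGen → Prop
  | K_Kinv : UqRel κ (FreeAlgebra.ι ℂ UqGen.K * FreeAlgebra.ι ℂ UqGen.Kinv) 1
  | Kinv_K : UqRel κ (FreeAlgebra.ι ℂ UqGen.Kinv * FreeAlgebra.ι ℂ UqGen.K) 1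
  | K_Jp : UqRel κ
      (FreeAlgebra.ι ℂ UqGen.K * FreeAlgebra.ι ℂ UqGen.Jp * FreeAlgebra.ι ℂ UqGen.Kinv)
      ((qpow κ 1 : ℂ) • FreeAlgebra.ι ℂ UqGen.Jp)
  | K_Jm : UqRel κ
      (FreeAlgebra.ι ℂ UqGen.K * FreeAlgebra.ι ℂ UqGen.Jm * FreeAlgebra.ι ℂ UqGen.Kinv)
      ((qpow κ (-1) : ℂ) • FreeAlgebra.ι ℂ UqGen.Jm)
  | Jp_Jm : UqRel κ
      (FreeAlgebra.ι ℂ UqGen.Jp * FreeAlgebra.ι ℂ UqGen.Jm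
        - FreeAlgebra.ι ℂ UqGen.Jm * FreeAlgebra.ι ℂ UqGen.Jp)
      (((qpow κ 1 - qpow κ (-1) : ℝ) : ℂ)⁻¹ •
        (FreeAlgebra.ι ℂ UqGen.K * FreeAlgebra.ι ℂ UqGen.K
          - FreeAlgebra.ι ℂ UqGen.Kinv * FreeAlgebra.ι ℂ UqGen.Kinv))

/-- The algebra `U_q(su(2))` (over `ℂ`). -/
def Uq (κ : ℝ) : Type := RingQuot (UqRel κ)

instance (κ : ℝ) : Ring (Uq κ) := inferInstanceAs (Ring (RingQuot (UqRel κ)))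

instance (κ : ℝ) : Algebra ℂ (Uq κ) := inferInstanceAs (Algebra ℂ (RingQuot (UqRel κ)))

/-- The quotient map from the free algebra. -/
def Uq.mk (κ : ℝ) : FreeAlgebra ℂ UqGen →ₐ[ℂ] Uq κ := RingQuot.mkAlgHom ℂ (UqRel κ)

lemma Uq.mk_rel (κ : ℝ) {x y : FreeAlgebra ℂ UqGen} (h : UqRel κ x y) :
    Uq.mk κ x = Uq.mk κ y := RingQuot.mkAlgHom_rel ℂ h

namespace Uq

/-- The class of a generator in `U_q(su(2))`. -/
def gen (κ : ℝ) (g : UqGen) : Uq κ := mk κ (FreeAlgebra.ι ℂ g)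

/-- Values on the four generators. -/
def onGen {A : Type*} (k ki jp jm : A) : UqGen → A
  | UqGen.K => k
  | UqGen.Kinv => ki
  | UqGen.Jp => jp
  | UqGen.Jm => jm

/-- The universal property of `U_q(su(2))`. -/
def lift (κ : ℝ) {A : Type*} [Ring A] [Algebra ℂ A] (k ki jp jm : A)
    (h1 : k * ki = 1) (h2 : ki * k = 1)
    (h3 : k * jp * ki = (qpow κ 1 : ℂ) • jp) (h4 : k * jm * ki = (qpow κ (-1) : ℂ) • jm)
    (h5 : jp * jm - jm * jp
      = ((qpow κ 1 - qpow κ (-1) : ℝ) : ℂ)⁻¹ • (k * k - ki * ki)) : Uq κ →ₐ[ℂ] A :=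
  RingQuot.liftAlgHom ℂ ⟨FreeAlgebra.lift ℂ (onGen k ki jp jm), by
    intro x y h
    cases h <;> simp [onGen, h1, h2, h3, h4, h5, -Complex.coe_smul]⟩

lemma K_Kinv (κ : ℝ) : gen κ UqGen.K * gen κ UqGen.Kinv = 1 := by
  have := mk_rel κ (UqRel.K_Kinv (κ := κ))
  simpa [gen, -Complex.coe_smul] using this

lemma Kinv_K (κ : ℝ) : gen κ UqGen.Kinv * gen κ UqGen.K = 1 := by
  have := mk_rel κ (UqRel.Kinv_K (κ := κ))
  simpa [gen, -Complex.coe_smul] using this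

lemma K_Jp (κ : ℝ) : gen κ UqGen.K * gen κ UqGen.Jp * gen κ UqGen.Kinv
    = (qpow κ 1 : ℂ) • gen κ UqGen.Jp := by
  have := mk_rel κ (UqRel.K_Jp (κ := κ))
  simpa [gen, -Complex.coe_smul] using this

lemma K_Jm (κ : ℝ) : gen κ UqGen.K * gen κ UqGen.Jm * gen κ UqGen.Kinv
    = (qpow κ (-1) : ℂ) • gen κ UqGen.Jm := by
  have := mk_rel κ (UqRel.K_Jm (κ := κ))
  simpa [gen, -Complex.coe_smul] using this

lemma Jp_Jm (κ : ℝ) : gen κ UqGen.Jp * gen κ UqGen.Jm - gen κ UqGen.Jm * gen κ UqGen.Jp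
    = ((qpow κ 1 - qpow κ (-1) : ℝ) : ℂ)⁻¹ •
      (gen κ UqGen.K * gen κ UqGen.K - gen κ UqGen.Kinv * gen κ UqGen.Kinv) := by
  have := mk_rel κ (UqRel.Jp_Jm (κ := κ))
  simpa [gen, -Complex.coe_smul] using this

lemma qpow_mul_neg (κ : ℝ) : (qpow κ 1 : ℂ) * (qpow κ (-1) : ℂ) = 1 := by
  rw [← Complex.ofReal_mul, qpow, qpow, ← Real.exp_add]; simp

lemma qpow_neg_mul (κ : ℝ) : (qpow κ (-1) : ℂ) * (qpow κ 1 : ℂ) = 1 := by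
  rw [mul_comm, qpow_mul_neg]

lemma K_mul_Jp (κ : ℝ) : gen κ UqGen.K * gen κ UqGen.Jp
    = (qpow κ 1 : ℂ) • (gen κ UqGen.Jp * gen κ UqGen.K) := by
  rw [← smul_mul_assoc, ← K_Jp, mul_assoc, Kinv_K, mul_one]

lemma K_mul_Jm (κ : ℝ) : gen κ UqGen.K * gen κ UqGen.Jm
    = (qpow κ (-1) : ℂ) • (gen κ UqGen.Jm * gen κ UqGen.K) := by
  rw [← smul_mul_assoc, ← K_Jm, mul_assoc, Kinv_K, mul_one]

lemma Kinv_mul_Jp (κ : ℝ) : gen κ UqGen.Kinv * gen κ UqGen.Jp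
    = (qpow κ (-1) : ℂ) • (gen κ UqGen.Jp * gen κ UqGen.Kinv) := by
  have h : gen κ UqGen.Jp * gen κ UqGen.Kinv
      = (qpow κ 1 : ℂ) • (gen κ UqGen.Kinv * gen κ UqGen.Jp) := by
    rw [← mul_smul_comm, ← K_Jp, ← mul_assoc, ← mul_assoc, Kinv_K, one_mul]
  rw [h, smul_smul, qpow_neg_mul, one_smul]

lemma Kinv_mul_Jm (κ : ℝ) : gen κ UqGen.Kinv * gen κ UqGen.Jm
    = (qpow κ 1 : ℂ) • (gen κ UqGen.Jm * gen κ UqGen.Kinv) := by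
  have h : gen κ UqGen.Jm * gen κ UqGen.Kinv
      = (qpow κ (-1) : ℂ) • (gen κ UqGen.Kinv * gen κ UqGen.Jm) := by
    rw [← mul_smul_comm, ← K_Jm, ← mul_assoc, ← mul_assoc, Kinv_K, one_mul]
  rw [h, smul_smul, qpow_mul_neg, one_smul]

/-- The comultiplication: `Δ(q^{±J_z}) = q^{±J_z} ⊗ q^{±J_z}` and
`Δ(J_±) = q^{-J_z} ⊗ J_± + J_± ⊗ q^{J_z}`. -/
def comul (κ : ℝ) : Uq κ →ₐ[ℂ] Uq κ ⊗[ℂ] Uq κ :=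
  lift κ (A := Uq κ ⊗[ℂ] Uq κ) (gen κ UqGen.K ⊗ₜ[ℂ] gen κ UqGen.K) (gen κ UqGen.Kinv ⊗ₜ[ℂ] gen κ UqGen.Kinv)
    (gen κ UqGen.Kinv ⊗ₜ[ℂ] gen κ UqGen.Jp + gen κ UqGen.Jp ⊗ₜ[ℂ] gen κ UqGen.K)
    (gen κ UqGen.Kinv ⊗ₜ[ℂ] gen κ UqGen.Jm + gen κ UqGen.Jm ⊗ₜ[ℂ] gen κ UqGen.K)
    (by simp [K_Kinv, Algebra.TensorProduct.one_def])
    (by simp [Kinv_K, Algebra.TensorProduct.one_def])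
    (by
      simp only [mul_add, add_mul, Algebra.TensorProduct.tmul_mul_tmul, mul_assoc, K_Kinv, mul_one,
        smul_add]
      rw [← mul_assoc, K_Jp, TensorProduct.tmul_smul, one_mul, ← TensorProduct.smul_tmul'])
    (by
      simp only [mul_add, add_mul, Algebra.TensorProduct.tmul_mul_tmul, mul_assoc, K_Kinv, mul_one,
        smul_add]
      rw [← mul_assoc, K_Jm, TensorProduct.tmul_smul, one_mul, ← TensorProduct.smul_tmul'])
    (by
      have e := Jp_Jm κ
      rw [sub_eq_iff_eq_add] at e
      simp only [mul_add, add_mul, Algebra.TensorProduct.tmul_mul_tmul, Kinv_mul_Jp,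
        Kinv_mul_Jm, K_mul_Jp, K_mul_Jm, e, TensorProduct.tmul_add, TensorProduct.add_tmul,
        TensorProduct.tmul_smul, ← TensorProduct.smul_tmul', TensorProduct.tmul_sub,
        TensorProduct.sub_tmul, smul_sub]
      abel)

/-- The algebra antimorphism with `q^{±J_z} ↦ q^{∓J_z}` and `J_± ↦ -q^{±r} J_±`. -/
def antipodeAux (κ r : ℝ) : Uq κ →ₐ[ℂ] (Uq κ)ᵐᵒᵖ :=
  lift κ (A := (Uq κ)ᵐᵒᵖ) (MulOpposite.op (gen κ UqGen.Kinv)) (MulOpposite.op (gen κ UqGen.K))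
    (MulOpposite.op (-((qpow κ r : ℂ) • gen κ UqGen.Jp)))
    (MulOpposite.op (-((qpow κ (-r) : ℂ) • gen κ UqGen.Jm)))
    (by rw [← MulOpposite.op_mul, K_Kinv, MulOpposite.op_one])
    (by rw [← MulOpposite.op_mul, Kinv_K, MulOpposite.op_one])
    (by
      rw [← MulOpposite.op_mul, ← MulOpposite.op_mul, ← MulOpposite.op_smul]
      congr 1
      rw [neg_mul, mul_neg, smul_neg, smul_mul_assoc, mul_smul_comm, ← mul_assoc,
        K_Jp, smul_comm])
    (by
      rw [← MulOpposite.op_mul, ← MulOpposite.op_mul, ← MulOpposite.op_smul]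
      congr 1
      rw [neg_mul, mul_neg, smul_neg, smul_mul_assoc, mul_smul_comm, ← mul_assoc,
        K_Jm, smul_comm])
    (by
      have hr : (qpow κ r : ℂ) * (qpow κ (-r) : ℂ) = 1 := by
        rw [← Complex.ofReal_mul, qpow, qpow, ← Real.exp_add]; simp
      simp only [← MulOpposite.op_mul, ← MulOpposite.op_sub, ← MulOpposite.op_smul]
      congr 1
      simp only [neg_mul_neg, smul_mul_assoc, mul_smul_comm, smul_smul, hr,
        mul_comm (qpow κ (-r) : ℂ), one_smul]
      rw [← neg_sub, Jp_Jm, ← smul_neg, neg_sub])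

/-- The antipode of `U_q(su(2))`: `S(q^{±J_z}) = q^{∓J_z}`, `S(J_±) = -q^{±1} J_±`. -/
def antipode (κ : ℝ) : Uq κ →ₗ[ℂ] Uq κ :=
  (MulOpposite.opLinearEquiv ℂ).symm.toLinearMap ∘ₗ (antipodeAux κ 1).toLinearMap

/-- The inverse of the antipode: `S⁻¹(q^{±J_z}) = q^{∓J_z}`, `S⁻¹(J_±) = -q^{∓1} J_±`. -/
def antipodeInv (κ : ℝ) : Uq κ →ₗ[ℂ] Uq κ :=
  (MulOpposite.opLinearEquiv ℂ).symm.toLinearMap ∘ₗ (antipodeAux κ (-1)).toLinearMap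

end Uq

/-! ### The irreducible representations `π_I` of `U_q(su(2))` -/

lemma qpow_add (κ x y : ℝ) : qpow κ (x + y) = qpow κ x * qpow κ y := by
  rw [qpow, qpow, qpow, ← Real.exp_add]; ring_nf

lemma qpow_neg (κ x : ℝ) : qpow κ (-x) = (qpow κ x)⁻¹ := by
  rw [qpow, qpow, ← Real.exp_neg]; ring_nf

lemma qpow_pos (κ x : ℝ) : 0 < qpow κ x := Real.exp_pos _

lemma qnum_nonneg (κ : ℝ) {x : ℝ} (hx : 0 ≤ x) : 0 ≤ qnum κ x := by
  unfold qnum qpow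
  rcases le_total 0 κ with h | h
  · apply div_nonneg_of_nonpos <;> rw [sub_nonpos] <;> apply Real.exp_le_exp.2 <;> nlinarith
  · apply div_nonneg <;> rw [sub_nonneg] <;> apply Real.exp_le_exp.2 <;> nlinarith

lemma qnum_identity (κ x y : ℝ) :
    qnum κ x * qnum κ (y + 1) - qnum κ y * qnum κ (x + 1)
      = (qpow κ 1 - qpow κ (-1))⁻¹ * (qpow κ (x - y) - qpow κ (-(x - y))) := by
  have hx := (qpow_pos κ x).ne'
  have hy := (qpow_pos κ y).ne'
  have h1 := (qpow_pos κ 1).ne'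
  by_cases hd : qpow κ 1 - qpow κ (-1) = 0
  · simp [qnum, hd]
  · simp only [qnum, sub_eq_add_neg x y, qpow_neg, qpow_add] at hd ⊢
    have hd' : qpow κ 1 ^ 2 - 1 ≠ 0 := by
      intro h
      apply hd
      field_simp
      linarith
    field_simp
    ring

/-- `π_I(q^{J_z}) e_m = q^m e_m`, where `j = 2I` and `m = a - I`; here `s = ±1` gives
`q^{±J_z}`. -/
def matK (κ : ℝ) (j : ℕ) (s : ℝ) : Matrix (Fin (j + 1)) (Fin (j + 1)) ℂ :=
  Matrix.diagonal fun a : Fin (j + 1) => (qpow κ (s * (((a : ℕ) : ℝ) - (j : ℝ) / 2)) : ℂ)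

/-- `π_I(J_+) e_m = ([I - m] [I + m + 1])^{1/2} e_{m+1}`. -/
def matJp (κ : ℝ) (j : ℕ) : Matrix (Fin (j + 1)) (Fin (j + 1)) ℂ :=
  Matrix.of fun b a => if (b : ℕ) = a + 1 then
    (Real.sqrt (qnum κ ((j : ℝ) - (a : ℕ)) * qnum κ (((a : ℕ) : ℝ) + 1)) : ℂ) else 0

/-- `π_I(J_-) e_m = ([I + m] [I - m + 1])^{1/2} e_{m-1}`. -/
def matJm (κ : ℝ) (j : ℕ) : Matrix (Fin (j + 1)) (Fin (j + 1)) ℂ :=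
  Matrix.of fun b a => if (a : ℕ) = b + 1 then
    (Real.sqrt (qnum κ ((a : ℕ) : ℝ) * qnum κ ((j : ℝ) - (a : ℕ) + 1)) : ℂ) else 0

lemma matK_mul (κ : ℝ) (j : ℕ) (s t : ℝ) : matK κ j s * matK κ j t = matK κ j (s + t) := by
  simp only [matK, Matrix.diagonal_mul_diagonal, ← Complex.ofReal_mul, ← qpow_add, add_mul]

lemma matK_zero (κ : ℝ) (j : ℕ) : matK κ j 0 = 1 := by
  simp [matK, qpow]

lemma matJp_mul_matJm (κ : ℝ) (j : ℕ) : matJp κ j * matJm κ j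
    = Matrix.diagonal fun a : Fin (j + 1) => ((qnum κ ((a : ℕ) : ℝ) * qnum κ ((j : ℝ) - (a : ℕ) + 1) : ℝ) : ℂ) := by
  ext b c
  rw [Matrix.mul_apply]
  have key : ∀ x : Fin (j + 1), matJp κ j b x * matJm κ j x c
      = if (b : ℕ) = x + 1 ∧ b = c then
        ((qnum κ ((b : ℕ) : ℝ) * qnum κ ((j : ℝ) - (b : ℕ) + 1) : ℝ) : ℂ) else 0 := by
    intro x
    by_cases h1 : (b : ℕ) = x + 1
    · by_cases h2 : b = c
      · subst h2
        have hb : ((b : ℕ) : ℝ) = ((x : ℕ) : ℝ) + 1 := by exact_mod_cast h1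
        have hj : ((x : ℕ) : ℝ) + 1 ≤ j := by
          have : (x : ℕ) + 1 ≤ j := by omega
          exact_mod_cast this
        have e : (j : ℝ) - (x : ℕ) = (j : ℝ) - (b : ℕ) + 1 := by rw [hb]; ring
        have p1 : 0 ≤ qnum κ ((b : ℕ) : ℝ) := qnum_nonneg κ (by positivity)
        have p2 : 0 ≤ qnum κ ((j : ℝ) - (b : ℕ) + 1) := qnum_nonneg κ (by rw [hb]; linarith)
        simp only [matJp, matJm, Matrix.of_apply, h1, if_true, and_self]
        rw [← h1, ← hb, e, ← Complex.ofReal_mul, mul_comm (qnum κ ((j : ℝ) - (b : ℕ) + 1)),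
          Real.mul_self_sqrt (mul_nonneg p1 p2)]
      · have : (c : ℕ) ≠ x + 1 := fun h => h2 (Fin.ext (by omega))
        simp [matJm, this, h2]
    · simp [matJp, h1]
  simp only [key]
  by_cases h2 : b = c
  · subst h2
    simp only [and_true, Matrix.diagonal_apply_eq]
    by_cases h0 : (b : ℕ) = 0
    · have : ∀ x : Fin (j + 1), ¬ (b : ℕ) = x + 1 := fun x => by omega
      simp only [this, if_false, Finset.sum_const_zero]
      simp [h0, qnum]
    · rw [Finset.sum_eq_single (⟨b - 1, by omega⟩ : Fin (j + 1))]
      · simp only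
        rw [if_pos (by omega)]
      · intro x _ hx
        rw [if_neg]
        intro h
        exact hx (Fin.ext (by simp only; omega))
      · simp
  · simp [h2]

lemma matJm_mul_matJp (κ : ℝ) (j : ℕ) : matJm κ j * matJp κ j
    = Matrix.diagonal fun a : Fin (j + 1) => ((qnum κ ((j : ℝ) - (a : ℕ)) * qnum κ (((a : ℕ) : ℝ) + 1) : ℝ) : ℂ) := by
  ext b c
  rw [Matrix.mul_apply]
  have key : ∀ x : Fin (j + 1), matJm κ j b x * matJp κ j x c
      = if (x : ℕ) = b + 1 ∧ b = c then
        ((qnum κ ((j : ℝ) - (b : ℕ)) * qnum κ (((b : ℕ) : ℝ) + 1) : ℝ) : ℂ) else 0 := by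
    intro x
    by_cases h1 : (x : ℕ) = b + 1
    · by_cases h2 : b = c
      · subst h2
        have hb : ((x : ℕ) : ℝ) = ((b : ℕ) : ℝ) + 1 := by exact_mod_cast h1
        have hj : ((b : ℕ) : ℝ) + 1 ≤ j := by
          have : (b : ℕ) + 1 ≤ j := by omega
          exact_mod_cast this
        have e : (j : ℝ) - (x : ℕ) + 1 = (j : ℝ) - (b : ℕ) := by rw [hb]; ring
        have p1 : 0 ≤ qnum κ ((j : ℝ) - (b : ℕ)) := qnum_nonneg κ (by linarith)
        have p2 : 0 ≤ qnum κ (((b : ℕ) : ℝ) + 1) := qnum_nonneg κ (by positivity)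
        simp only [matJp, matJm, Matrix.of_apply, h1, if_true, and_self]
        rw [← h1, e, hb, ← Complex.ofReal_mul, mul_comm (qnum κ (((b : ℕ) : ℝ) + 1)),
          Real.mul_self_sqrt (mul_nonneg p1 p2)]
      · have : ¬ (x : ℕ) = c + 1 := fun h => h2 (Fin.ext (by omega))
        simp [matJp, this, h2]
    · simp [matJm, h1]
  simp only [key]
  by_cases h2 : b = c
  · subst h2
    simp only [and_true, Matrix.diagonal_apply_eq]
    by_cases h0 : (b : ℕ) = j
    · have : ∀ x : Fin (j + 1), ¬ (x : ℕ) = b + 1 := fun x => by omega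
      simp only [this, if_false, Finset.sum_const_zero]
      simp [h0, qnum]
    · rw [Finset.sum_eq_single (⟨b + 1, by omega⟩ : Fin (j + 1))]
      · simp
      · intro x _ hx
        rw [if_neg]
        intro h
        exact hx (Fin.ext h)
      · simp
  · simp [h2]

/-- The representation `π_I`, `j = 2I`, in the orthonormal basis `(e^I_m)`:
`rep κ j x m n` is the matrix element `π_I(x)^m_n`. -/
def rep (κ : ℝ) (j : ℕ) : Uq κ →ₐ[ℂ] Matrix (Fin (j + 1)) (Fin (j + 1)) ℂ :=
  Uq.lift κ (matK κ j 1) (matK κ j (-1)) (matJp κ j) (matJm κ j)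
    (by rw [matK_mul, add_neg_cancel, matK_zero])
    (by rw [matK_mul, neg_add_cancel, matK_zero])
    (by
      ext b a
      simp only [matK, Matrix.mul_diagonal, Matrix.diagonal_mul, matJp, Matrix.of_apply,
        Matrix.smul_apply, smul_eq_mul]
      split_ifs with h
      · have hb : ((b : ℕ) : ℝ) = ((a : ℕ) : ℝ) + 1 := by exact_mod_cast h
        rw [mul_right_comm, ← Complex.ofReal_mul, ← qpow_add, hb]
        ring_nf
      · simp)
    (by
      ext b a
      simp only [matK, Matrix.mul_diagonal, Matrix.diagonal_mul, matJm, Matrix.of_apply,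
        Matrix.smul_apply, smul_eq_mul]
      split_ifs with h
      · have hb : ((a : ℕ) : ℝ) = ((b : ℕ) : ℝ) + 1 := by exact_mod_cast h
        rw [mul_right_comm, ← Complex.ofReal_mul, ← qpow_add, hb]
        ring_nf
      · simp)
    (by
      rw [matJp_mul_matJm, matJm_mul_matJp, matK_mul, matK_mul, matK, matK,
        Matrix.diagonal_sub, Matrix.diagonal_sub, ← Matrix.diagonal_smul]
      congr 1
      funext a
      have h := qnum_identity κ ((a : ℕ) : ℝ) ((j : ℝ) - (a : ℕ))
      simp only [Pi.smul_apply, smul_eq_mul]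
      rw [← Complex.ofReal_sub, h]
      push_cast
      ring_nf)

/-! ### Clebsch-Gordan coefficients -/

/-- The Clebsch-Gordan coefficient of spins `I = i/2`, `J = j/2`, `K = k/2` and magnetic numbers
`n = a - I`, `p = b - J`, `m = c - K`.  The bases are orthonormal and the coefficients real, so
this is at the same time the coefficient of `e^I_n ⊗ e^J_p` in `C^{IJ}_K (e^K_m)` and that of
`e^K_m` in `C^K_{IJ} (e^I_n ⊗ e^J_p)`. -/
def cg (κ : ℝ) (i j k a b c : ℕ) : ℝ :=
  if (i + j + k) % 2 = 0 ∧ k ≤ i + j ∧ i ≤ j + k ∧ j ≤ i + k ∧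
      a ≤ i ∧ b ≤ j ∧ c ≤ k ∧ 2 * a + 2 * b + k = 2 * c + i + j then
    Real.sqrt (qnum κ ((k : ℝ) + 1)
      * (qfact κ ((i + j - k) / 2) * qfact κ ((i + k - j) / 2) * qfact κ ((j + k - i) / 2)
        / qfact κ ((i + j + k) / 2 + 1))
      * (qfact κ a * qfact κ (i - a) * qfact κ b * qfact κ (j - b)
        * qfact κ c * qfact κ (k - c)))
    * qpow κ ((((i : ℝ) + j - k) / 2 * (((i : ℝ) + j + k) / 2 + 1)) / 2
        + (i : ℝ) / 2 * ((b : ℝ) - (j : ℝ) / 2) - (j : ℝ) / 2 * ((a : ℝ) - (i : ℝ) / 2))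
    * ∑ z ∈ Finset.range ((i + j - k) / 2 + 1),
        (-1) ^ z * qpow κ (-(z : ℝ) * (((i : ℝ) + j + k) / 2 + 1))
        * qinvFact κ z
        * qinvFact κ ((((i + j - k) / 2 : ℕ) : ℤ) - z)
        * qinvFact κ ((i : ℤ) - a - z)
        * qinvFact κ ((b : ℤ) - z)
        * qinvFact κ ((a : ℤ) - (((i + j - k) / 2 : ℕ) : ℤ) + z)
        * qinvFact κ ((j : ℤ) - b - (((i + j - k) / 2 : ℕ) : ℤ) + z)
  else 0

/-! ### The Hopf algebra `F_q(SU(2))` -/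

/-- The index set of the basis `u_I{}^m{}_n` of `F_q(SU(2))`. -/
abbrev FqIdx : Type := Σ j : ℕ, Fin (j + 1) × Fin (j + 1)

/-- The vector space `F_q(SU(2))`, with basis the matrix elements `u_I{}^m{}_n`. -/
def Fq : Type := FqIdx →₀ ℂ

instance : AddCommGroup Fq := inferInstanceAs (AddCommGroup (FqIdx →₀ ℂ))

instance : Module ℂ Fq := inferInstanceAs (Module ℂ (FqIdx →₀ ℂ))

namespace Fq

/-- The basis of `F_q(SU(2))`. -/
def basis : Module.Basis FqIdx ℂ Fq := Module.Basis.ofRepr (LinearEquiv.refl ℂ (FqIdx →₀ ℂ))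

/-- The matrix element `u_I{}^m{}_n`, `j = 2I`. -/
def u (j : ℕ) (m n : Fin (j + 1)) : Fq := basis ⟨j, m, n⟩

/-- The duality pairing `⟨x, u_I{}^m{}_n⟩ = π_I(x)^m_n`. -/
def pairing (κ : ℝ) (j : ℕ) (m n : Fin (j + 1)) : Uq κ →ₗ[ℂ] ℂ :=
  Matrix.entryLinearMap ℂ ℂ m n ∘ₗ (rep κ j).toLinearMap

/-- The product `u_I{}^m{}_n · u_J{}^p{}_q = ∑ (m p; I J | K r) u_K{}^r{}_s (s K | I J; n q)`. -/
def mul (κ : ℝ) : Fq →ₗ[ℂ] Fq →ₗ[ℂ] Fq :=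
  basis.constr ℂ fun x => basis.constr ℂ fun y =>
    ∑ K ∈ Finset.range (x.1 + y.1 + 1), ∑ r : Fin (K + 1), ∑ s : Fin (K + 1),
      ((cg κ x.1 y.1 K x.2.1 y.2.1 r * cg κ x.1 y.1 K x.2.2 y.2.2 s : ℝ) : ℂ) • u K r s

/-- The unit `1 = u_0{}^0{}_0`. -/
def one : Fq := u 0 0 0

/-- `ε_{I mn} = e^{-iπ(I+m)} q^{I(I+1)} q^{-m} δ_{m,-n}`, where `j = 2I`, `m = a - I`,
`n = b - I`. -/
def eps (κ : ℝ) (j : ℕ) : Matrix (Fin (j + 1)) (Fin (j + 1)) ℂ :=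
  Matrix.of fun a b => if (a : ℕ) + b = j then
    (-1) ^ (a : ℕ) * (qpow κ ((j : ℝ) / 2 * ((j : ℝ) / 2 + 1)) : ℂ)
      * (qpow κ (-(((a : ℕ) : ℝ) - (j : ℝ) / 2)) : ℂ) else 0

/-- The antipode of `F_q(SU(2))`, `S(u^m_n) = ∑ ε_{np} u^p_q (ε⁻¹)^{qm}`. -/
def antipode (κ : ℝ) : Fq →ₗ[ℂ] Fq :=
  basis.constr ℂ fun x => ∑ p, ∑ r,
    (eps κ x.1 x.2.2 p * (eps κ x.1)⁻¹ r x.2.1) • u x.1 p r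

/-- The inverse of the antipode of `F_q(SU(2))`, `S⁻¹(u^m_n) = ∑ (ε⁻¹)^{mp} u^q_p ε_{qn}`.
It is the antipode of `F_q(SU(2))` with opposite coproduct. -/
def antipodeInv (κ : ℝ) : Fq →ₗ[ℂ] Fq :=
  basis.constr ℂ fun x => ∑ p, ∑ r,
    ((eps κ x.1)⁻¹ x.2.1 p * eps κ x.1 r x.2.2) • u x.1 r p

end Fq

/-! ### The quantum Lorentz group: the quantum double of `U_q(su(2))` -/

/-- `y ↦ ∑ φ(y₍₁₎) ψ(y₍₃₎) y₍₂₎`. -/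
def Uq.sandwich (κ : ℝ) (φ ψ : Uq κ →ₗ[ℂ] ℂ) : Uq κ →ₗ[ℂ] Uq κ :=
  (TensorProduct.lid ℂ (Uq κ)).toLinearMap
    ∘ₗ TensorProduct.map φ
      ((TensorProduct.rid ℂ (Uq κ)).toLinearMap
        ∘ₗ TensorProduct.map LinearMap.id ψ ∘ₗ (Uq.comul κ).toLinearMap)
    ∘ₗ (Uq.comul κ).toLinearMap

/-- The underlying vector space `U_q(su(2)) ⊗ F_q(SU(2))` of the quantum double. -/
abbrev QLG (κ : ℝ) : Type := Uq κ ⊗[ℂ] Fq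

namespace QLG

/-- The exchange relation of the quantum double, which writes `f · y` (`f ∈ F_q(SU(2))`,
`y ∈ U_q(su(2))`) in normal order:
`f · y = ∑ ⟨S⁻¹(y₍₁₎), f₍₃₎⟩ ⟨y₍₃₎, f₍₁₎⟩ y₍₂₎ ⊗ f₍₂₎`, where
`Δ(u^m_n) = ∑ u^m_p ⊗ u^p_n` is the coproduct of `F_q(SU(2))`. -/
def exchange (κ : ℝ) : Fq →ₗ[ℂ] Uq κ →ₗ[ℂ] QLG κ :=
  Fq.basis.constr ℂ fun x => ∑ k, ∑ l,
    (TensorProduct.mk ℂ (Uq κ) Fq).flip (Fq.u x.1 k l) ∘ₗ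
      Uq.sandwich κ (Fq.pairing κ x.1 l x.2.2 ∘ₗ Uq.antipodeInv κ) (Fq.pairing κ x.1 x.2.1 k)

/-- The product of the quantum double,
`(x ⊗ f) (y ⊗ g) = ∑ ⟨S⁻¹(y₍₁₎), f₍₃₎⟩ ⟨y₍₃₎, f₍₁₎⟩ x y₍₂₎ ⊗ f₍₂₎ g`. -/
def mul (κ : ℝ) : QLG κ ⊗[ℂ] QLG κ →ₗ[ℂ] QLG κ :=
  TensorProduct.map (LinearMap.mul' ℂ (Uq κ)) (TensorProduct.lift (Fq.mul κ))
    ∘ₗ (TensorProduct.assoc ℂ (Uq κ) (Uq κ) (Fq ⊗[ℂ] Fq)).symm.toLinearMap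
    ∘ₗ LinearMap.lTensor (Uq κ) (TensorProduct.assoc ℂ (Uq κ) Fq Fq).toLinearMap
    ∘ₗ LinearMap.lTensor (Uq κ) (LinearMap.rTensor Fq (TensorProduct.lift (exchange κ)))
    ∘ₗ LinearMap.lTensor (Uq κ) (TensorProduct.assoc ℂ Fq (Uq κ) Fq).symm.toLinearMap
    ∘ₗ (TensorProduct.assoc ℂ (Uq κ) Fq (Uq κ ⊗[ℂ] Fq)).toLinearMap

/-- The embedding of `U_q(su(2))`. -/
def ofUq (κ : ℝ) : Uq κ →ₗ[ℂ] QLG κ := (TensorProduct.mk ℂ (Uq κ) Fq).flip Fq.one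

/-- The embedding of `F_q(SU(2))`. -/
def ofFq (κ : ℝ) : Fq →ₗ[ℂ] QLG κ := TensorProduct.mk ℂ (Uq κ) Fq 1

/-- The antipode of the quantum double.  It restricts to the antipodes of the Hopf subalgebras
`U_q(su(2))` and `F_q(SU(2))^{op}` (opposite coproduct), and `S(x f) = S(f) S(x)`. -/
def antipode (κ : ℝ) : QLG κ →ₗ[ℂ] QLG κ :=
  mul κ
    ∘ₗ TensorProduct.map (ofFq κ ∘ₗ Fq.antipodeInv κ) (ofUq κ ∘ₗ Uq.antipode κ)
    ∘ₗ (TensorProduct.comm ℂ (Uq κ) Fq).toLinearMap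

end QLG

/-! ### Principal representations

The label `α = (n, p)` consists of `n ∈ ℤ/2`, encoded by the integer `2n` (called `n` below), and
a real number `p`. -/

/-- The labels of the principal series. -/
def IsPrincipal (κ : ℝ) (n : ℤ) (p : ℝ) : Prop :=
  p ∈ Set.Ico 0 (4 * Real.pi / κ) ∨ n = 0 ∧ p ∈ Set.Icc 0 (2 * Real.pi / κ)

/-- The index set of the basis `e^I_m` of `V_α`, where `I = |n|, |n| + 1, ...`: the pair `⟨k, a⟩`
stands for the spin `I = |n| + k` and `m = a - I`. -/
abbrev VIdx (n : ℤ) : Type := Σ k : ℕ, Fin (n.natAbs + 2 * k + 1)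

/-- The space `V_α = ⨁ V_I`. -/
abbrev V (n : ℤ) : Type := VIdx n →₀ ℂ

/-- The basis vector `e^I_m`. -/
def e {n : ℤ} (x : VIdx n) : V n := Finsupp.single x 1

/-- The sum which occurs in the 6j symbol `{A B L; M J x}` with `2A + 1 = s + n`,
`2B + 1 = s - n`, `x = A + σ`, `σ = r - J`, without the triangle coefficients (in this
description all spins are the true ones).  It is written so that it makes sense for every complex
number `s`. -/
def sixJSum (κ : ℝ) (n : ℤ) (s : ℂ) (J M L r : ℕ) : ℂ :=
  ∑ k ∈ Finset.range (J + 1),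
    (-1) ^ k
    * (∏ i ∈ Finset.range ((M + J + L) / 2 + 1), qnumC κ (s - (L : ℂ) / 2 - k + i))
    * ((qinvFact κ k
      * qinvFact κ (((L : ℤ) + 2 * r - J - M) / 2 + k)
      * qinvFact κ (((L : ℤ) + n) / 2 + r - J + k)
      * qinvFact κ (((M : ℤ) + J - L) / 2 - k)
      * qinvFact κ (((M : ℤ) - n - 2 * r + J) / 2 - k)
      * qinvFact κ ((J : ℤ) - r - k) : ℝ) : ℂ)

/-- The squares of the triangle coefficients of `(J, A, x)` and `(x, B, M)`, times `[2x + 1]` and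
`q^{2 x(x+1) - 2 A(A+1)}`, where `x = A + σ`, `σ = r - J` (true spins again). -/
def sixJWeight (κ : ℝ) (n : ℤ) (s : ℂ) (J M r : ℕ) : ℂ :=
  qpowC κ ((2 * (r : ℂ) - J) * (s + (n : ℂ) / 2) + (2 * (r : ℂ) - J) ^ 2 / 2)
  * ((qfact κ r * qfact κ (J - r) : ℝ) : ℂ)
  * qnumC κ (s + (n : ℂ) / 2 + (2 * (r : ℂ) - J))
  / (∏ i ∈ Finset.range (J + 1), qnumC κ (s + (n : ℂ) / 2 + r - J + i))
  * ((qfact κ (((M : ℤ) + n + 2 * r - J) / 2).toNat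
      * qfact κ (((M : ℤ) - n - 2 * r + J) / 2).toNat : ℝ) : ℂ)
  / (∏ i ∈ Finset.range (M + 1), qnumC κ (s + r - (J : ℂ) / 2 - (M : ℂ) / 2 + i))

/-- The triangle coefficients of `(A, B, L)` and `(M, J, L)`, times `[2L + 1]^{1/2}`.  For
imaginary `s = A + B + 1` the square of the first one is
`[L+n]! [L-n]! / ∏_{|k| ≤ L} [s+k]`, that is, `(-1)^{L-|n|} [L+n]! [L-n]!` divided by
`∏_{|k| ≤ |n|} [s+k]` and by `∏_{|n| < k ≤ L} |[s+k]|²`; the first of these products and the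
root `(-i)^{L-|n|}` of the sign are left out here and put into `lambdaSum` and `lambda`. -/
def sixJNorm (κ : ℝ) (n : ℤ) (s : ℂ) (J M L : ℕ) : ℝ :=
  Real.sqrt (qfact κ (((L : ℤ) + n) / 2).toNat * qfact κ (((L : ℤ) - n) / 2).toNat
    * qnum κ ((L : ℝ) + 1)
    * (qfact κ ((M + J - L) / 2) * qfact κ ((M + L - J) / 2) * qfact κ ((J + L - M) / 2)
      / qfact κ ((M + J + L) / 2 + 1)))
  / ∏ i ∈ Finset.range ((L - n.natAbs) / 2),
      ‖qnumC κ (s + (n.natAbs : ℂ) / 2 + 1 + i)‖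

/-- The sum over `x` of products of two continued 6j symbols, as a function of `t`, where
`s = A + B + 1 = i t / 2`. -/
def lambdaSum (κ : ℝ) (n : ℤ) (J M N L : ℕ) (t : ℝ) : ℂ :=
  (sixJNorm κ n (Complex.I * t / 2) J M N : ℂ) * (sixJNorm κ n (Complex.I * t / 2) J M L : ℂ)
  / (∏ i ∈ Finset.range (n.natAbs + 1),
      qnumC κ (Complex.I * t / 2 - (n.natAbs : ℂ) / 2 + i))
  * ∑ r ∈ Finset.range (J + 1),
      sixJWeight κ n (Complex.I * t / 2) J M r
        * sixJSum κ n (Complex.I * t / 2) J M N r * sixJSum κ n (Complex.I * t / 2) J M L r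

/-- The coefficient `Λ^{JM}_{NL}(α)`, `α = (n, p)`; the arguments `J M N L` are twice the spins.
It is the analytic continuation, to `2A + 1 = ip/2 + n` and `2B + 1 = ip/2 - n`, of
`(-1)^{N+J-M} ∑_x q^{c_N/2 + c_L/2 - c_M - c_J + 2 c_x - 2 c_A} R_{Nx} R_{Lx}`,
where `c_I = I(I+1)` and `R_{Lx}` is the matrix of Racah coefficients
`(-1)^{A+B+J+M} ([2x+1] [2L+1])^{1/2} {A B L; M J x}`.
As a function of `p` the sum has only removable singularities (where some q-number in a
denominator vanishes); the limit gives the value there and is the value elsewhere. -/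
def lambda (κ : ℝ) (n : ℤ) (p : ℝ) (J M N L : ℕ) : ℂ :=
  (-1) ^ ((N + J - M) / 2) * (-Complex.I) ^ ((N + L) / 2 - n.natAbs)
  * (qpow κ (((N : ℝ) / 2 * ((N : ℝ) / 2 + 1) + (L : ℝ) / 2 * ((L : ℝ) / 2 + 1)) / 2
      - (M : ℝ) / 2 * ((M : ℝ) / 2 + 1) - (J : ℝ) / 2 * ((J : ℝ) / 2 + 1)) : ℂ)
  * Filter.limUnder (nhdsWithin p {p}ᶜ) (lambdaSum κ n J M N L)

/-- The standard action of `U_q(su(2))` on `V_α = ⨁ V_I`. -/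
def actUq (κ : ℝ) (n : ℤ) : Uq κ →ₗ[ℂ] Module.End ℂ (V n) where
  toFun x := Finsupp.linearCombination ℂ fun y : VIdx n =>
    ∑ b, rep κ (n.natAbs + 2 * y.1) x b y.2 • e (⟨y.1, b⟩ : VIdx n)
  map_add' x y := by
    ext z : 2
    simp [add_smul, Finset.sum_add_distrib]
  map_smul' c x := by
    ext z : 2
    simp [mul_smul, Finset.smul_sum]

/-- The action of `F_q(SU(2))` on `V_α`:
`u_J{}^n{}_{n'} e^L_p = ∑ e^N_{p'} (p' n; N J | M m) (m M | J L; n' p) Λ^{JM}_{NL}(α)`. The sums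
run over all spins `N ∈ |n| + ℕ` and `M` for which the Clebsch-Gordan coefficients do not
vanish. -/
def actFq (κ : ℝ) (n : ℤ) (p : ℝ) : Fq →ₗ[ℂ] Module.End ℂ (V n) :=
  Fq.basis.constr ℂ fun x => Finsupp.linearCombination ℂ fun y : VIdx n =>
    ∑ k ∈ Finset.range (y.1 + x.1 + 1), ∑ p' : Fin (n.natAbs + 2 * k + 1),
      ∑ M ∈ Finset.range (x.1 + (n.natAbs + 2 * y.1) + 1), ∑ m : Fin (M + 1),
        (((cg κ (n.natAbs + 2 * k) x.1 M p' x.2.1 m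
          * cg κ x.1 (n.natAbs + 2 * y.1) M x.2.2 y.2 m : ℝ) : ℂ)
          * lambda κ n p x.1 M (n.natAbs + 2 * k) (n.natAbs + 2 * y.1)) • e (⟨k, p'⟩ : VIdx n)

/-- The principal representation `π_α` of the quantum Lorentz group on `V_α`, `α = (n, p)`. -/
def principal (κ : ℝ) (n : ℤ) (p : ℝ) : QLG κ →ₗ[ℂ] Module.End ℂ (V n) :=
  TensorProduct.lift ((LinearMap.mul ℂ (Module.End ℂ (V n))).compl₁₂ (actUq κ n) (actFq κ n p))

/-- The dual `V_α^* = ⨁ V_I^*`, as the span of the dual basis `e^{Ia}` in the algebraic dual. -/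
def dualV (n : ℤ) : Submodule ℂ (Module.Dual ℂ (V n)) :=
  Submodule.span ℂ (Set.range fun x : VIdx n => Finsupp.lapply x)

/-- The matrix element `φ^α_{IaJb} = c q^{-I(I+1)} δ_{IJ} ε_{I ba}`. -/
def phiEntry (κ : ℝ) (n : ℤ) (c : ℂ) (x y : VIdx n) : ℂ :=
  if h : y.1 = x.1 then
    c * (qpow κ (-(((n.natAbs + 2 * x.1 : ℕ) : ℝ) / 2
        * (((n.natAbs + 2 * x.1 : ℕ) : ℝ) / 2 + 1))) : ℂ)
      * Fq.eps κ (n.natAbs + 2 * x.1) (Fin.cast (by rw [h]) y.2) x.2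
  else 0

/-- The bilinear form `β_α(v, w) = φ^α(w)(v)`. -/
def beta {n : ℤ} (φ : V n →ₗ[ℂ] dualV n) : V n →ₗ[ℂ] V n →ₗ[ℂ] ℂ :=
  ((dualV n).subtype ∘ₗ φ).flip

end QLorentz

end

noncomputable section

namespace QLorentz

/-! ### q-factorials -/

/-! The form pairs `e^I_m` only with `e^I_{-m}`. The factor `q^{-I(I+1)}` cancels the one in `ε`, so
the value of the pairing is a multiple of `(-1)^{I+m} q^{-m}` (`formVal_eq`). It never vanishes,
which gives bijectivity onto the span of the dual basis.

Intertwining and invariance of `β_α` are one identity, linear in `a`, so `a = x f` with `x ∈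
U_q(su(2))` and `f ∈ F_q(SU(2))` suffices. Three facts are then needed.

(1) `π_α(S(x f)) = π_α(S(f)) π_α(S(x))`. The product `S(f) S(x)` must first be put in normal order,
so `π_α` has to respect the exchange relation of the double (`principal_exchange`). In matrix form,
with `U = (π_α(u^m_n))`, the relation says that `U` intertwines `V_J ⊗ V_α` with `V_α ⊗ V_J`
(`conjAct_comul₃`). This holds for arbitrary coefficients `Λ`, because every term is a
Clebsch-Gordan map followed by the transpose of another one. That these maps commute with `J_+` is a
three-term recursion for a q-hypergeometric sum, proved by telescoping (`cgSum_recursion`); the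
`J_-` case and the transposed maps follow by symmetry.

(2) Invariance under `U_q(su(2))`: `ε` intertwines `π_I` with its contragredient (`eps_mul_rep`),
and the remaining factor is a scalar on each block `V_I`.

(3) Invariance under `F_q(SU(2))` (`twist_swap`): Clebsch-Gordan coefficients are unchanged when the
two factors are exchanged and all magnetic numbers reversed. Up to its sign prefactor, `Λ^{JM}_{NL}`
is symmetric in `N` and `L`. The signs and powers of `q` left over cancel against the values of the
form by conservation of the magnetic number. No other property of `Λ` enters, so 6j identities and
the evaluation of the limits are not needed. -/

lemma qpow_zero (κ : ℝ) : qpow κ 0 = 1 := by simp [qpow]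

lemma qpow_sub (κ x y : ℝ) : qpow κ (x - y) = qpow κ x * (qpow κ y)⁻¹ := by
  rw [sub_eq_add_neg, qpow_add, qpow_neg]

lemma qpow_one_sub_ne_zero {κ : ℝ} (hκ : 0 < κ) : qpow κ 1 - qpow κ (-1) ≠ 0 := by
  have : qpow κ 1 < qpow κ (-1) := Real.exp_lt_exp.2 (by linarith)
  linarith

lemma qnum_zero (κ : ℝ) : qnum κ 0 = 0 := by simp [qnum]

lemma qnum_pos {κ : ℝ} (hκ : 0 < κ) {x : ℝ} (hx : 0 < x) : 0 < qnum κ x := by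
  refine div_pos_of_neg_of_neg ?_ ?_ <;> rw [sub_neg] <;> apply Real.exp_lt_exp.2 <;> nlinarith

lemma qfact_zero (κ : ℝ) : qfact κ 0 = 1 := by simp [qfact]

lemma qfact_succ (κ : ℝ) (m : ℕ) : qfact κ (m + 1) = qfact κ m * qnum κ ((m : ℝ) + 1) :=
  Finset.prod_range_succ _ _

lemma qfact_pos {κ : ℝ} (hκ : 0 < κ) (m : ℕ) : 0 < qfact κ m :=
  Finset.prod_pos fun _ _ => qnum_pos hκ (by positivity)

lemma qinvFact_natCast (κ : ℝ) (m : ℕ) : qinvFact κ m = (qfact κ m)⁻¹ := by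
  simp [qinvFact]

lemma qinvFact_of_neg (κ : ℝ) {z : ℤ} (hz : z < 0) : qinvFact κ z = 0 := if_pos hz

lemma qinvFact_sub_one {κ : ℝ} (hκ : 0 < κ) (z : ℤ) :
    qinvFact κ (z - 1) = qnum κ z * qinvFact κ z := by
  rcases lt_trichotomy z 0 with h | rfl | h
  · rw [qinvFact_of_neg κ h, qinvFact_of_neg κ (by omega), mul_zero]
  · rw [qinvFact_of_neg κ (by omega)]
    simp [qnum_zero]
  · obtain ⟨m, rfl⟩ : ∃ m : ℕ, z = m + 1 := ⟨(z - 1).toNat, by omega⟩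
    have h1 := (qnum_pos hκ (x := (m : ℝ) + 1) (by positivity)).ne'
    have h2 := (qfact_pos hκ m).ne'
    rw [add_sub_cancel_right, qinvFact_natCast, ← Nat.cast_succ, qinvFact_natCast,
      Nat.succ_eq_add_one, qfact_succ]
    push_cast
    field_simp

/-! ### The Clebsch-Gordan coefficients intertwine -/

/-- The sum in the Clebsch-Gordan coefficient of spins `I`, `J`, `I + J - s`. -/
def cgSum (κ : ℝ) (i j s : ℕ) (a b : ℤ) : ℝ :=
  ∑ z ∈ Finset.range (s + 1),
    (-1) ^ z * qpow κ (-(z : ℝ) * ((i : ℝ) + j - s + 1))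
    * qinvFact κ z * qinvFact κ ((s : ℤ) - z) * qinvFact κ ((i : ℤ) - a - z)
    * qinvFact κ (b - z) * qinvFact κ (a - s + z) * qinvFact κ ((j : ℤ) - b - s + z)

/-- The telescoping certificate for `cgSum_recursion`, with the common summand divided out. Every
term contains exactly three q-numbers, so the denominator `q - q⁻¹` can stay opaque and what remains
is an identity of Laurent polynomials. -/
lemma qnum_certificate {κ : ℝ} (hκ : 0 < κ) (i j s a b z : ℝ) :
    qpow κ (i - a) * qnum κ (b + 1) * (qnum κ (a + 1 - s + z) * qnum κ (j - b - s + z))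
      + qpow κ (b - j) * qnum κ (a + 1) * (qnum κ (i - a - z) * qnum κ (b + 1 - z))
      - qnum κ (i + j - s - a - b) * (qnum κ (b + 1 - z) * qnum κ (a + 1 - s + z))
    = qpow κ (i - a + b + 1) * (qpow κ (-(i + j - s + 1)) * qpow κ (-(z + 1))
          * (qnum κ (s - z) * qnum κ (i - a - z) * qnum κ (b + 1 - z))
        + qpow κ (-z) * (qnum κ z * qnum κ (a + 1 - s + z) * qnum κ (j - b - s + z))) := by
  have hd := qpow_one_sub_ne_zero hκ
  have h1 := (qpow_pos κ 1).ne'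
  have hi := (qpow_pos κ i).ne'
  have hj := (qpow_pos κ j).ne'
  have hs := (qpow_pos κ s).ne'
  have ha := (qpow_pos κ a).ne'
  have hb := (qpow_pos κ b).ne'
  have hz := (qpow_pos κ z).ne'
  simp only [qnum]
  generalize hD : qpow κ 1 - qpow κ (-1) = D at hd
  have hD' : qpow κ 1 ^ 2 = D * qpow κ 1 + 1 := by
    rw [← hD, qpow_neg]; field_simp; ring
  simp only [qpow_add, qpow_sub, qpow_neg]
  field_simp
  generalize qpow κ 1 = x at *
  generalize qpow κ i = x at *
  generalize qpow κ j = x at *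
  generalize qpow κ s = x at *
  generalize qpow κ a = x at *
  generalize qpow κ b = x at *
  generalize qpow κ z = x at *
  ring

/-- Creative telescoping: the difference of the two sides, taken summand by summand, equals `G (z +
1) - G z`, and `G` vanishes at both ends of the range. This is commutation with `J_+`, stripped of
normalizations. -/
lemma cgSum_recursion {κ : ℝ} (hκ : 0 < κ) (i j s : ℕ) (a b : ℤ) :
    qpow κ ((i : ℝ) - a) * qnum κ ((b : ℝ) + 1) * cgSum κ i j s a (b + 1)
      + qpow κ ((b : ℝ) - j) * qnum κ ((a : ℝ) + 1) * cgSum κ i j s (a + 1) b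
    = qnum κ ((i : ℝ) + j - s - a - b) * cgSum κ i j s a b := by
  set w : ℕ → ℝ := fun z => (-1) ^ z * qpow κ (-(z : ℝ) * ((i : ℝ) + j - s + 1)) with hw
  -- Each factorial carries the largest argument occurring in the three sums, so each of their
  -- summands is `w z * D z` times two q-numbers.
  set D : ℕ → ℝ := fun z => qinvFact κ z * qinvFact κ ((s : ℤ) - z) * qinvFact κ ((i : ℤ) - a - z)
    * qinvFact κ (b + 1 - z) * qinvFact κ (a + 1 - s + z) * qinvFact κ ((j : ℤ) - b - s + z) with hD
  set G : ℕ → ℝ := fun z => -qpow κ ((i : ℝ) - a + b + 1) * qpow κ (-(z : ℝ)) *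
    (qnum κ z * qnum κ ((a : ℝ) + 1 - s + z) * qnum κ ((j : ℝ) - b - s + z)) * (w z * D z) with hG
  have hDs : ∀ z : ℕ, qnum κ ((z : ℝ) + 1) * qnum κ ((a : ℝ) + 1 - s + (z + 1))
      * qnum κ ((j : ℝ) - b - s + (z + 1)) * D (z + 1)
      = qnum κ ((s : ℝ) - z) * qnum κ ((i : ℝ) - a - z) * qnum κ ((b : ℝ) + 1 - z) * D z := by
    intro z
    have e1 := qinvFact_sub_one hκ ((z : ℤ) + 1)
    have e2 := qinvFact_sub_one hκ ((a : ℤ) + 1 - s + (z + 1))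
    have e3 := qinvFact_sub_one hκ ((j : ℤ) - b - s + (z + 1))
    have e4 := qinvFact_sub_one hκ ((s : ℤ) - z)
    have e5 := qinvFact_sub_one hκ ((i : ℤ) - a - z)
    have e6 := qinvFact_sub_one hκ ((b : ℤ) + 1 - z)
    rw [add_sub_cancel_right] at e1
    rw [show (a : ℤ) + 1 - s + (z + 1) - 1 = a + 1 - s + z by ring] at e2
    rw [show (j : ℤ) - b - s + (z + 1) - 1 = j - b - s + z by ring] at e3
    rw [sub_sub] at e4 e5 e6
    push_cast at e1 e2 e3 e4 e5 e6
    simp only [hD]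
    push_cast
    rw [e1, e2, e3, e4, e5, e6]
    ring
  have hsum : ∑ z ∈ Finset.range (s + 1), (G (z + 1) - G z) = 0 := by
    rw [Finset.sum_range_sub]
    have h0 : G 0 = 0 := by simp [hG, qnum_zero]
    have h1 : D (s + 1) = 0 := by
      simp only [hD]
      rw [qinvFact_of_neg κ (z := (s : ℤ) - (s + 1 : ℕ)) (by push_cast; omega)]
      simp
    simp only [h0, sub_zero]
    simp [hG, h1]
  rw [← sub_eq_zero, ← hsum]
  simp only [cgSum, Finset.mul_sum, ← Finset.sum_add_distrib, ← Finset.sum_sub_distrib]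
  refine Finset.sum_congr rfl fun z _ => ?_
  have hwz : w (z + 1) = -(w z * qpow κ (-((i : ℝ) + j - s + 1))) := by
    simp only [hw, pow_succ]
    push_cast
    rw [show -((z : ℝ) + 1) * ((i : ℝ) + j - s + 1)
      = -(z : ℝ) * ((i : ℝ) + j - s + 1) + -((i : ℝ) + j - s + 1) by ring, qpow_add]
    ring
  have hGs : G (z + 1) = qpow κ ((i : ℝ) - a + b + 1) * (qpow κ (-((i : ℝ) + j - s + 1))
      * qpow κ (-((z : ℝ) + 1)) * (qnum κ ((s : ℝ) - z) * qnum κ ((i : ℝ) - a - z)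
      * qnum κ ((b : ℝ) + 1 - z))) * (w z * D z) := by
    have := hDs z
    simp only [hG, hwz]
    push_cast
    linear_combination (qpow κ ((i : ℝ) - a + b + 1) * qpow κ (-((z : ℝ) + 1)) * w z
      * qpow κ (-((i : ℝ) + j - s + 1))) * this
  have e1 := qinvFact_sub_one hκ ((a : ℤ) + 1 - s + z)
  have e2 := qinvFact_sub_one hκ ((j : ℤ) - b - s + z)
  have e3 := qinvFact_sub_one hκ ((i : ℤ) - a - z)
  have e4 := qinvFact_sub_one hκ ((b : ℤ) + 1 - z)
  push_cast at e1 e2 e3 e4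
  have c := qnum_certificate hκ (i : ℝ) j s a b z
  rw [show (a : ℤ) - s + z = a + 1 - s + z - 1 by ring, show (i : ℤ) - (a + 1) - z = i - a - z - 1 by ring,
    show (j : ℤ) - (b + 1) - s + z = j - b - s + z - 1 by ring,
    show (b : ℤ) - z = b + 1 - z - 1 by ring, e1, e2, e3, e4, hGs]
  simp only [hG]
  simp only [hD]
  linear_combination (w z * (qinvFact κ z * qinvFact κ ((s : ℤ) - z) * qinvFact κ ((i : ℤ) - a - z)
    * qinvFact κ (b + 1 - z) * qinvFact κ (a + 1 - s + z) * qinvFact κ ((j : ℤ) - b - s + z))) * c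

/-- In each case every summand contains the inverse factorial of a negative integer; for `a + b < s`
this is because `b - z` and `a - s + z` have negative sum. -/
lemma cgSum_eq_zero {κ : ℝ} {i j s : ℕ} {a b : ℤ} (h : a + b < s ∨ j < b ∨ i < a) :
    cgSum κ i j s a b = 0 := by
  refine Finset.sum_eq_zero fun z hz => ?_
  rw [Finset.mem_range] at hz
  have : b - z < 0 ∨ a - s + z < 0 ∨ (j : ℤ) - b - s + z < 0 ∨ (i : ℤ) - a - z < 0 := by omega
  rcases this with h | h | h | h <;> simp [qinvFact_of_neg κ h]

/-- The substitution only permutes the inverse factorials inside each summand; `z` is not reindexed.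
-/
lemma cgSum_swap (κ : ℝ) (i j s : ℕ) (a b : ℤ) :
    cgSum κ j i s (j - b) (i - a) = cgSum κ i j s a b := by
  refine Finset.sum_congr rfl fun z _ => ?_
  rw [sub_sub_cancel, sub_sub_cancel, add_comm (j : ℝ) i]
  ring

/-- The squared normalization of the Clebsch-Gordan coefficients. -/
def cgNorm (κ : ℝ) (i j k : ℕ) : ℝ :=
  qnum κ ((k : ℝ) + 1)
    * (qfact κ ((i + j - k) / 2) * qfact κ ((i + k - j) / 2) * qfact κ ((j + k - i) / 2)
      / qfact κ ((i + j + k) / 2 + 1))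

/-- The exponent of `q` in front of the sum in the Clebsch-Gordan coefficients. -/
def cgExp (i j k : ℕ) (a b : ℝ) : ℝ :=
  (((i : ℝ) + j - k) / 2 * (((i : ℝ) + j + k) / 2 + 1)) / 2
    + (i : ℝ) / 2 * (b - (j : ℝ) / 2) - (j : ℝ) / 2 * (a - (i : ℝ) / 2)

lemma cg_eq_ite (κ : ℝ) {i j k s : ℕ} (h : i + j = k + 2 * s) (hi : s ≤ i) (hj : s ≤ j)
    (a b c : ℕ) :
    cg κ i j k a b c = if a ≤ i ∧ b ≤ j ∧ c ≤ k ∧ a + b = c + s then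
      Real.sqrt (cgNorm κ i j k * (qfact κ a * qfact κ (i - a) * qfact κ b * qfact κ (j - b)
        * qfact κ c * qfact κ (k - c))) * qpow κ (cgExp i j k a b) * cgSum κ i j s a b else 0 := by
  have hs : (i + j - k) / 2 = s := by omega
  have hk : (k : ℝ) = i + j - 2 * s := by
    have : (i : ℝ) + j = k + 2 * s := by exact_mod_cast h
    linarith
  rw [cg]
  refine if_congr ⟨fun _ => by omega, fun _ => by omega⟩ ?_ rfl
  simp only [cgSum, cgNorm, cgExp, hs]
  congr 1
  refine Finset.sum_congr rfl fun z _ => ?_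
  rw [show ((i : ℝ) + j + k) / 2 + 1 = (i : ℝ) + j - s + 1 by rw [hk]; ring]

lemma exists_triangle_of_cg_ne_zero {κ : ℝ} {i j k a b c : ℕ} (h : cg κ i j k a b c ≠ 0) :
    ∃ s, i + j = k + 2 * s ∧ s ≤ i ∧ s ≤ j := by
  rw [cg, ite_ne_right_iff] at h
  exact ⟨(i + j - k) / 2, by omega, by omega, by omega⟩

lemma cg_ne_zero_imp {κ : ℝ} {i j k a b c : ℕ} (h : cg κ i j k a b c ≠ 0) :
    a ≤ i ∧ b ≤ j ∧ c ≤ k ∧ 2 * a + 2 * b + k = 2 * c + i + j := by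
  rw [cg, ite_ne_right_iff] at h
  omega

lemma cgNorm_swap (κ : ℝ) (i j k : ℕ) : cgNorm κ j i k = cgNorm κ i j k := by
  simp only [cgNorm, add_comm j i]
  ring

/-- Reversing the magnetic numbers and exchanging the two factors. -/
lemma cg_swap (κ : ℝ) (i j k : ℕ) {a b c : ℕ} (ha : a ≤ i) (hb : b ≤ j) (hc : c ≤ k) :
    cg κ j i k (j - b) (i - a) (k - c) = cg κ i j k a b c := by
  by_cases H : ∃ s, i + j = k + 2 * s ∧ s ≤ i ∧ s ≤ j
  · obtain ⟨s, h, hi, hj⟩ := H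
    rw [cg_eq_ite κ h hi hj, cg_eq_ite κ (by omega : j + i = k + 2 * s) hj hi]
    refine if_congr ⟨fun _ => by omega, fun _ => by omega⟩ ?_ rfl
    rw [Nat.sub_sub_self ha, Nat.sub_sub_self hb, Nat.sub_sub_self hc, cgNorm_swap,
      Nat.cast_sub ha, Nat.cast_sub hb, Nat.cast_sub ha, Nat.cast_sub hb, cgSum_swap]
    congr 3
    · ring
    · simp only [cgExp]; ring
  · rw [not_imp_comm.1 exists_triangle_of_cg_ne_zero H, not_imp_comm.1 exists_triangle_of_cg_ne_zero]
    rintro ⟨s, h⟩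
    exact H ⟨s, by omega⟩

lemma qfact_mul_qfact_sub {κ : ℝ} {m b : ℕ} (hb : b + 1 ≤ m) :
    qnum κ ((m : ℝ) - b) * qnum κ ((b : ℝ) + 1) * (qfact κ (b + 1) * qfact κ (m - (b + 1)))
      = qnum κ ((b : ℝ) + 1) ^ 2 * (qfact κ b * qfact κ (m - b)) := by
  obtain ⟨d, rfl⟩ := Nat.exists_eq_add_of_le hb
  rw [show b + 1 + d - (b + 1) = d by omega, show b + 1 + d - b = d + 1 by omega, qfact_succ,
    qfact_succ, show ((b + 1 + d : ℕ) : ℝ) - b = d + 1 by push_cast; ring]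
  ring

/-- The matrix element of `J_+` is absorbed into the square root, which moves the normalization from
`b + 1` to `b`. All terms of the recursion then share one root. -/
lemma sqrt_qnum_mul_cg_right {κ : ℝ} {i j k s : ℕ} (h : i + j = k + 2 * s)
    (hi : s ≤ i) (hj : s ≤ j) {a b c : ℕ} (ha : a ≤ i) (hb : b ≤ j) (hc : c ≤ k)
    (habc : a + (b + 1) = c + s) :
    Real.sqrt (qnum κ ((j : ℝ) - b) * qnum κ ((b : ℝ) + 1)) * cg κ i j k a (b + 1) c
      = Real.sqrt (cgNorm κ i j k * (qfact κ a * qfact κ (i - a) * qfact κ b * qfact κ (j - b)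
        * qfact κ c * qfact κ (k - c))) * (qpow κ (cgExp i j k a b) * qpow κ ((i : ℝ) / 2)
        * qnum κ ((b : ℝ) + 1) * cgSum κ i j s a (b + 1)) := by
  -- At the highest weight `b = j` the left side vanishes through `[0]`, the right side through the
  -- sum.
  rcases hb.eq_or_lt with rfl | hb
  · rw [sub_self, qnum_zero, zero_mul, Real.sqrt_zero, zero_mul,
      cgSum_eq_zero (Or.inr (Or.inl (by omega)))]
    ring
  · rw [cg_eq_ite κ h hi hj, if_pos ⟨ha, hb, hc, habc⟩]
    have hq : 0 ≤ qnum κ ((b : ℝ) + 1) := qnum_nonneg κ (by positivity)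
    have e : cgExp i j k a ((b + 1 : ℕ) : ℝ) = cgExp i j k a b + (i : ℝ) / 2 := by
      simp only [cgExp]; push_cast; ring
    have hbj : (b : ℝ) + 1 ≤ j := by exact_mod_cast hb
    rw [e, qpow_add, mul_assoc, ← mul_assoc, ← mul_assoc, ← Real.sqrt_mul
      (mul_nonneg (qnum_nonneg κ (by linarith)) hq)]
    rw [show qnum κ ((j : ℝ) - b) * qnum κ ((b : ℝ) + 1) * (cgNorm κ i j k * (qfact κ a
        * qfact κ (i - a) * qfact κ (b + 1) * qfact κ (j - (b + 1)) * qfact κ c * qfact κ (k - c)))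
      = qnum κ ((b : ℝ) + 1) ^ 2 * (cgNorm κ i j k * (qfact κ a
        * qfact κ (i - a) * qfact κ b * qfact κ (j - b) * qfact κ c * qfact κ (k - c))) by
        linear_combination (cgNorm κ i j k * (qfact κ a
          * qfact κ (i - a) * qfact κ c * qfact κ (k - c))) * qfact_mul_qfact_sub hb,
      Real.sqrt_mul (sq_nonneg _), Real.sqrt_sq hq]
    push_cast
    ring

lemma sqrt_qnum_mul_cg_left {κ : ℝ} {i j k s : ℕ} (h : i + j = k + 2 * s)
    (hi : s ≤ i) (hj : s ≤ j) {a b c : ℕ} (ha : a ≤ i) (hb : b ≤ j) (hc : c ≤ k)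
    (habc : a + 1 + b = c + s) :
    Real.sqrt (qnum κ ((i : ℝ) - a) * qnum κ ((a : ℝ) + 1)) * cg κ i j k (a + 1) b c
      = Real.sqrt (cgNorm κ i j k * (qfact κ a * qfact κ (i - a) * qfact κ b * qfact κ (j - b)
        * qfact κ c * qfact κ (k - c))) * (qpow κ (cgExp i j k a b) * qpow κ (-((j : ℝ) / 2))
        * qnum κ ((a : ℝ) + 1) * cgSum κ i j s (a + 1) b) := by
  rcases ha.eq_or_lt with rfl | ha
  · rw [sub_self, qnum_zero, zero_mul, Real.sqrt_zero, zero_mul,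
      cgSum_eq_zero (Or.inr (Or.inr (by omega)))]
    ring
  · rw [cg_eq_ite κ h hi hj, if_pos ⟨ha, hb, hc, habc⟩]
    have hq : 0 ≤ qnum κ ((a : ℝ) + 1) := qnum_nonneg κ (by positivity)
    have e : cgExp i j k ((a + 1 : ℕ) : ℝ) b = cgExp i j k a b + -((j : ℝ) / 2) := by
      simp only [cgExp]; push_cast; ring
    have hai : (a : ℝ) + 1 ≤ i := by exact_mod_cast ha
    rw [e, qpow_add, mul_assoc, ← mul_assoc, ← mul_assoc, ← Real.sqrt_mul
      (mul_nonneg (qnum_nonneg κ (by linarith)) hq)]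
    rw [show qnum κ ((i : ℝ) - a) * qnum κ ((a : ℝ) + 1) * (cgNorm κ i j k * (qfact κ (a + 1)
        * qfact κ (i - (a + 1)) * qfact κ b * qfact κ (j - b) * qfact κ c * qfact κ (k - c)))
      = qnum κ ((a : ℝ) + 1) ^ 2 * (cgNorm κ i j k * (qfact κ a
        * qfact κ (i - a) * qfact κ b * qfact κ (j - b) * qfact κ c * qfact κ (k - c))) by
        linear_combination (cgNorm κ i j k * (qfact κ b
          * qfact κ (j - b) * qfact κ c * qfact κ (k - c))) * qfact_mul_qfact_sub ha,
      Real.sqrt_mul (sq_nonneg _), Real.sqrt_sq hq]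
    push_cast
    ring

/-- The left-hand side of the recursion satisfied by the Clebsch-Gordan coefficients. -/
lemma cg_recursion_aux {κ : ℝ} (hκ : 0 < κ) {i j k s : ℕ} (h : i + j = k + 2 * s)
    (hi : s ≤ i) (hj : s ≤ j) {a b c : ℕ} (ha : a ≤ i) (hb : b ≤ j) (hc : c ≤ k)
    (habc : a + b + 1 = c + s) :
    qpow κ (-((a : ℝ) - i / 2)) * Real.sqrt (qnum κ ((j : ℝ) - b) * qnum κ ((b : ℝ) + 1))
        * cg κ i j k a (b + 1) c
      + qpow κ ((b : ℝ) - j / 2) * Real.sqrt (qnum κ ((i : ℝ) - a) * qnum κ ((a : ℝ) + 1))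
        * cg κ i j k (a + 1) b c
    = Real.sqrt (cgNorm κ i j k * (qfact κ a * qfact κ (i - a) * qfact κ b * qfact κ (j - b)
        * qfact κ c * qfact κ (k - c))) * qpow κ (cgExp i j k a b)
        * (qnum κ ((i : ℝ) + j - s - a - b) * cgSum κ i j s a b) := by
  rw [mul_assoc, mul_assoc, sqrt_qnum_mul_cg_right h hi hj ha hb hc (by omega),
    sqrt_qnum_mul_cg_left h hi hj ha hb hc (by omega)]
  have r := cgSum_recursion hκ i j s a b
  push_cast at r
  rw [← r]
  have e1 : qpow κ ((i : ℝ) - a) = qpow κ (-((a : ℝ) - i / 2)) * qpow κ ((i : ℝ) / 2) := by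
    rw [← qpow_add]; ring_nf
  have e2 : qpow κ ((b : ℝ) - j) = qpow κ ((b : ℝ) - j / 2) * qpow κ (-((j : ℝ) / 2)) := by
    rw [← qpow_add]; ring_nf
  rw [e1, e2]
  ring

/-- `J_+` never reaches the lowest vector of `V_K`. Here `a + b < s`, so the sum on the right of
`cg_recursion_aux` is zero. -/
lemma cg_recursion_zero {κ : ℝ} (hκ : 0 < κ) (i j k : ℕ) {a b : ℕ} (ha : a ≤ i) (hb : b ≤ j) :
    qpow κ (-((a : ℝ) - i / 2)) * Real.sqrt (qnum κ ((j : ℝ) - b) * qnum κ ((b : ℝ) + 1))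
        * cg κ i j k a (b + 1) 0
      + qpow κ ((b : ℝ) - j / 2) * Real.sqrt (qnum κ ((i : ℝ) - a) * qnum κ ((a : ℝ) + 1))
        * cg κ i j k (a + 1) b 0 = 0 := by
  by_cases H : ∃ s, i + j = k + 2 * s ∧ s ≤ i ∧ s ≤ j
  · obtain ⟨s, h, hi, hj⟩ := H
    by_cases habc : a + b + 1 = 0 + s
    · rw [cg_recursion_aux hκ h hi hj ha hb (Nat.zero_le _) habc,
        cgSum_eq_zero (Or.inl (by omega))]
      ring
    · rw [cg_eq_ite κ h hi hj, cg_eq_ite κ h hi hj, if_neg (by omega), if_neg (by omega)]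
      ring
  · rw [not_imp_comm.1 exists_triangle_of_cg_ne_zero H, not_imp_comm.1 exists_triangle_of_cg_ne_zero H]
    ring

lemma cg_recursion_succ {κ : ℝ} (hκ : 0 < κ) (i j k : ℕ) {a b c : ℕ} (ha : a ≤ i) (hb : b ≤ j)
    (hc : c + 1 ≤ k) :
    qpow κ (-((a : ℝ) - i / 2)) * Real.sqrt (qnum κ ((j : ℝ) - b) * qnum κ ((b : ℝ) + 1))
        * cg κ i j k a (b + 1) (c + 1)
      + qpow κ ((b : ℝ) - j / 2) * Real.sqrt (qnum κ ((i : ℝ) - a) * qnum κ ((a : ℝ) + 1))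
        * cg κ i j k (a + 1) b (c + 1)
    = Real.sqrt (qnum κ ((k : ℝ) - c) * qnum κ ((c : ℝ) + 1)) * cg κ i j k a b c := by
  by_cases H : ∃ s, i + j = k + 2 * s ∧ s ≤ i ∧ s ≤ j
  · obtain ⟨s, h, hi, hj⟩ := H
    by_cases habc : a + b = c + s
    · rw [cg_recursion_aux hκ h hi hj ha hb hc (by omega), cg_eq_ite κ h hi hj a b c,
        if_pos ⟨ha, hb, by omega, habc⟩]
      have hck : (c : ℝ) + 1 ≤ k := by exact_mod_cast hc
      have hq : 0 ≤ qnum κ ((k : ℝ) - c) := qnum_nonneg κ (by linarith)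
      have hab : (a : ℝ) + b = c + s := by exact_mod_cast habc
      have hij : (i : ℝ) + j = k + 2 * s := by exact_mod_cast h
      have e : qnum κ ((c : ℝ) + 1) * (qfact κ c * qfact κ (k - c))
          = qnum κ ((k : ℝ) - c) * (qfact κ (c + 1) * qfact κ (k - (c + 1))) := by
        obtain ⟨d, rfl⟩ := Nat.exists_eq_add_of_le hc
        rw [show c + 1 + d - (c + 1) = d by omega, show c + 1 + d - c = d + 1 by omega, qfact_succ,
          qfact_succ, show ((c + 1 + d : ℕ) : ℝ) - c = d + 1 by push_cast; ring]
        ring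
      have hr : Real.sqrt (qnum κ ((k : ℝ) - c) * qnum κ ((c : ℝ) + 1)) * Real.sqrt (cgNorm κ i j k
            * (qfact κ a * qfact κ (i - a) * qfact κ b * qfact κ (j - b) * qfact κ c * qfact κ (k - c)))
          = qnum κ ((k : ℝ) - c) * Real.sqrt (cgNorm κ i j k * (qfact κ a * qfact κ (i - a)
            * qfact κ b * qfact κ (j - b) * qfact κ (c + 1) * qfact κ (k - (c + 1)))) := by
        rw [← Real.sqrt_mul (mul_nonneg hq (qnum_nonneg κ (by positivity))), ← Real.sqrt_sq hq,
          ← Real.sqrt_mul (sq_nonneg _), Real.sqrt_sq hq]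
        congr 1
        linear_combination (qnum κ ((k : ℝ) - c) * cgNorm κ i j k * (qfact κ a
            * qfact κ (i - a) * qfact κ b * qfact κ (j - b))) * e
      rw [show (i : ℝ) + j - s - a - b = k - c by linarith]
      linear_combination (-qpow κ (cgExp i j k a b) * cgSum κ i j s a b) * hr
    · rw [cg_eq_ite κ h hi hj, cg_eq_ite κ h hi hj, cg_eq_ite κ h hi hj, if_neg (by omega),
        if_neg (by omega), if_neg (by omega)]
      ring
  · simp only [not_imp_comm.1 exists_triangle_of_cg_ne_zero H]
    ring

/-- Coupling with the trivial representation. -/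
lemma cg_zero_right {κ : ℝ} (hκ : 0 < κ) {i a c : ℕ} (ha : a ≤ i) :
    cg κ i 0 i a 0 c = if c = a then 1 else 0 := by
  rw [cg_eq_ite κ (s := 0) (by omega) (by omega) (by omega)]
  by_cases hc : c = a
  · subst hc
    rw [if_pos ⟨ha, le_rfl, ha, by omega⟩, if_pos rfl]
    have h1 := (qfact_pos hκ c).ne'
    have h2 := (qfact_pos hκ (i - c)).ne'
    have h3 := (qfact_pos hκ i).ne'
    have h4 := (qnum_pos hκ (x := (i : ℝ) + 1) (by positivity)).ne'
    have hs : cgSum κ i 0 0 c (0 : ℕ) = (qfact κ (i - c))⁻¹ * (qfact κ c)⁻¹ := by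
      have e : ((i : ℤ) - c) = ((i - c : ℕ) : ℤ) := by omega
      have e0 : qinvFact κ 0 = 1 := by simpa [qfact_zero] using qinvFact_natCast κ 0
      simp [cgSum, qpow_zero, e, e0, qfact_zero, qinvFact_natCast]
    have hE : cgExp i 0 i c (0 : ℕ) = 0 := by simp [cgExp]
    have hN : cgNorm κ i 0 i = 1 := by
      simp only [cgNorm, show (i + 0 - i) / 2 = 0 by omega, show (i + i - 0) / 2 = i by omega,
        show (0 + i - i) / 2 = 0 by omega, show (i + 0 + i) / 2 + 1 = i + 1 by omega, qfact_zero,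
        qfact_succ]
      field_simp
    rw [hs, hE, hN, qpow_zero]
    simp only [qfact_zero, Nat.sub_zero]
    rw [show 1 * (qfact κ c * qfact κ (i - c) * 1 * 1 * qfact κ c * qfact κ (i - c))
      = (qfact κ c * qfact κ (i - c)) ^ 2 by ring,
      Real.sqrt_sq (mul_nonneg (qfact_pos hκ _).le (qfact_pos hκ _).le)]
    field_simp
  · rw [if_neg (by omega), if_neg hc]

/-! ### Clebsch-Gordan matrices as morphisms of `U_q(su(2))`-modules -/

open scoped Kronecker

lemma Uq.lift_gen (κ : ℝ) {A : Type*} [Ring A] [Algebra ℂ A] (k ki jp jm : A)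
    (h1 : k * ki = 1) (h2 : ki * k = 1)
    (h3 : k * jp * ki = (qpow κ 1 : ℂ) • jp) (h4 : k * jm * ki = (qpow κ (-1) : ℂ) • jm)
    (h5 : jp * jm - jm * jp
      = ((qpow κ 1 - qpow κ (-1) : ℝ) : ℂ)⁻¹ • (k * k - ki * ki)) (g : UqGen) :
    Uq.lift κ k ki jp jm h1 h2 h3 h4 h5 (Uq.gen κ g) = Uq.onGen k ki jp jm g :=
  (RingQuot.liftAlgHom_mkAlgHom_apply ℂ _ _ _).trans (FreeAlgebra.lift_ι_apply _ _)

@[simp] lemma rep_K (κ : ℝ) (j : ℕ) : rep κ j (Uq.gen κ UqGen.K) = matK κ j 1 :=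
  Uq.lift_gen ..

@[simp] lemma rep_Kinv (κ : ℝ) (j : ℕ) : rep κ j (Uq.gen κ UqGen.Kinv) = matK κ j (-1) :=
  Uq.lift_gen ..

@[simp] lemma rep_Jp (κ : ℝ) (j : ℕ) : rep κ j (Uq.gen κ UqGen.Jp) = matJp κ j :=
  Uq.lift_gen ..

@[simp] lemma rep_Jm (κ : ℝ) (j : ℕ) : rep κ j (Uq.gen κ UqGen.Jm) = matJm κ j :=
  Uq.lift_gen ..

lemma matK_transpose (κ : ℝ) (j : ℕ) (s : ℝ) : (matK κ j s).transpose = matK κ j s :=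
  Matrix.diagonal_transpose _

lemma matJp_transpose (κ : ℝ) (j : ℕ) : (matJp κ j).transpose = matJm κ j := by
  ext b a
  simp only [Matrix.transpose_apply, matJp, matJm, Matrix.of_apply]
  by_cases h : (a : ℕ) = b + 1
  · rw [if_pos h, if_pos h, h]
    push_cast
    ring_nf
  · rw [if_neg h, if_neg h]

lemma matK_rev (κ : ℝ) (j : ℕ) (s : ℝ) (a b : Fin (j + 1)) :
    matK κ j s a.rev b.rev = matK κ j (-s) a b := by
  simp only [matK, Matrix.diagonal_apply, Fin.rev_inj]
  refine if_congr Iff.rfl ?_ rfl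
  rw [Fin.val_rev, Nat.cast_sub (by omega)]
  push_cast
  ring_nf

lemma matJp_rev (κ : ℝ) (j : ℕ) (a b : Fin (j + 1)) :
    matJp κ j a.rev b.rev = matJm κ j a b := by
  simp only [matJp, matJm, Matrix.of_apply, Fin.val_rev]
  by_cases h : (b : ℕ) = a + 1
  · rw [if_pos (by omega), if_pos h, Nat.cast_sub (by omega)]
    push_cast
    ring_nf
  · rw [if_neg (by omega), if_neg h]

lemma sum_mul_matK (κ : ℝ) (j : ℕ) (s : ℝ) (f : Fin (j + 1) → ℂ) (a : Fin (j + 1)) :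
    ∑ x, f x * matK κ j s x a = f a * (qpow κ (s * (((a : ℕ) : ℝ) - (j : ℝ) / 2)) : ℂ) := by
  simp [matK, Matrix.diagonal_apply]

lemma sum_mul_matJp (κ : ℝ) (j : ℕ) (f : ℕ → ℂ) (hf : f (j + 1) = 0) (a : Fin (j + 1)) :
    ∑ x : Fin (j + 1), f x * matJp κ j x a = f (a + 1)
      * (Real.sqrt (qnum κ ((j : ℝ) - (a : ℕ)) * qnum κ (((a : ℕ) : ℝ) + 1)) : ℂ) := by
  rcases (Nat.lt_succ_iff.1 a.2).eq_or_lt with h | h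
  · rw [h, hf, zero_mul]
    refine Finset.sum_eq_zero fun x _ => ?_
    rw [matJp, Matrix.of_apply, if_neg (by omega), mul_zero]
  · rw [Finset.sum_eq_single (⟨a + 1, by omega⟩ : Fin (j + 1))]
    · simp [matJp]
    · intro x _ hx
      rw [matJp, Matrix.of_apply, if_neg (fun h => hx (Fin.ext h)), mul_zero]
    · simp

/-- The Clebsch-Gordan coefficients as the matrix of a map `V_I ⊗ V_J → V_K`. -/
def cgMat (κ : ℝ) (i j k : ℕ) : Matrix (Fin (k + 1)) (Fin (i + 1) × Fin (j + 1)) ℂ :=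
  Matrix.of fun c x => (cg κ i j k x.1 x.2 c : ℂ)

lemma cgMat_mul_matK (κ : ℝ) (i j k : ℕ) (s : ℝ) :
    cgMat κ i j k * (matK κ i s ⊗ₖ matK κ j s) = matK κ k s * cgMat κ i j k := by
  ext c ⟨a, b⟩
  rw [matK, matK, matK, Matrix.diagonal_kronecker_diagonal, Matrix.mul_diagonal,
    Matrix.diagonal_mul]
  simp only [cgMat, Matrix.of_apply]
  by_cases h : cg κ i j k a b c = 0
  · simp [h]
  · have h' := (cg_ne_zero_imp h).2.2.2
    have h'' : 2 * ((a : ℕ) : ℝ) + 2 * (b : ℕ) + k = 2 * (c : ℕ) + i + j := by exact_mod_cast h'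
    rw [← Complex.ofReal_mul, ← qpow_add, ← mul_add, mul_comm,
      show ((a : ℕ) : ℝ) - i / 2 + ((b : ℕ) - j / 2) = (c : ℕ) - k / 2 by linarith]

lemma cgMat_mul_matJp {κ : ℝ} (hκ : 0 < κ) (i j k : ℕ) :
    cgMat κ i j k * (matK κ i (-1) ⊗ₖ matJp κ j + matJp κ i ⊗ₖ matK κ j 1)
      = matJp κ k * cgMat κ i j k := by
  ext c ⟨a, b⟩
  have hi : ∀ b c, cg κ i j k (i + 1) b c = 0 := fun b c => by
    by_contra h; have := (cg_ne_zero_imp h).1; omega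
  have hj : ∀ a c, cg κ i j k a (j + 1) c = 0 := fun b c => by
    by_contra h; have := (cg_ne_zero_imp h).2.1; omega
  have e1 : (cgMat κ i j k * (matK κ i (-1) ⊗ₖ matJp κ j)) c (a, b)
      = ((qpow κ (-((a : ℕ) - (i : ℝ) / 2)) * Real.sqrt (qnum κ ((j : ℝ) - (b : ℕ))
        * qnum κ (((b : ℕ) : ℝ) + 1)) * cg κ i j k a (b + 1) c : ℝ) : ℂ) := by
    rw [Matrix.mul_apply, Fintype.sum_prod_type_right]
    simp only [cgMat, Matrix.of_apply, Matrix.kroneckerMap_apply, ← mul_assoc]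
    simp only [← Finset.sum_mul, sum_mul_matK κ i _ (fun x => (cg κ i j k x _ c : ℂ))]
    rw [sum_mul_matJp κ j (fun x => (cg κ i j k a x c : ℂ) * _) (by simp [hj])]
    push_cast
    ring_nf
  have e2 : (cgMat κ i j k * (matJp κ i ⊗ₖ matK κ j 1)) c (a, b)
      = ((qpow κ ((b : ℕ) - (j : ℝ) / 2) * Real.sqrt (qnum κ ((i : ℝ) - (a : ℕ))
        * qnum κ (((a : ℕ) : ℝ) + 1)) * cg κ i j k (a + 1) b c : ℝ) : ℂ) := by
    rw [Matrix.mul_apply, Fintype.sum_prod_type]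
    simp only [cgMat, Matrix.of_apply, Matrix.kroneckerMap_apply,
      mul_comm (matJp κ i _ _), ← mul_assoc]
    simp only [← Finset.sum_mul, sum_mul_matK κ j _ (fun x => (cg κ i j k _ x c : ℂ))]
    rw [sum_mul_matJp κ i (fun x => (cg κ i j k x b c : ℂ) * _) (by simp [hi])]
    push_cast
    ring_nf
  rw [Matrix.mul_add, Matrix.add_apply, e1, e2, ← Complex.ofReal_add, Matrix.mul_apply]
  have ha : (a : ℕ) ≤ i := by omega
  have hb : (b : ℕ) ≤ j := by omega
  obtain ⟨c, hc⟩ := c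
  rcases c with - | c
  · rw [cg_recursion_zero hκ i j k ha hb, Finset.sum_eq_zero, Complex.ofReal_zero]
    intro x _
    simp [matJp]
  · rw [cg_recursion_succ hκ i j k ha hb (by omega),
      Finset.sum_eq_single (⟨c, by omega⟩ : Fin (k + 1))]
    · simp [matJp, cgMat]
    · intro x _ hx
      rw [matJp, Matrix.of_apply, if_neg (fun h => hx (Fin.ext (by simp only at h ⊢; omega))),
        zero_mul]
    · simp

/-- Exchange of the two tensor factors and reversal of the magnetic numbers. -/
def revSwap (i j : ℕ) : Fin (i + 1) × Fin (j + 1) ≃ Fin (j + 1) × Fin (i + 1) :=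
  (Equiv.prodComm _ _).trans (Equiv.prodCongr Fin.revPerm Fin.revPerm)

lemma cgMat_submatrix (κ : ℝ) (i j k : ℕ) :
    (cgMat κ j i k).submatrix Fin.revPerm (revSwap i j) = cgMat κ i j k := by
  ext c ⟨a, b⟩
  simp only [cgMat, revSwap, Matrix.submatrix_apply, Matrix.of_apply, Equiv.trans_apply,
    Equiv.prodComm_apply, Prod.swap_prod_mk, Equiv.prodCongr_apply, Prod.map_apply,
    Fin.revPerm_apply, Fin.val_rev]
  rw [← cg_swap κ i j k (a := a) (b := b) (c := c) (by omega) (by omega) (by omega)]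
  congr 2 <;> omega

/-- No second recursion is needed: reversing magnetic numbers turns `J_+` into `J_-` and inverts
`q^{J_z}`, and exchanging the factors restores the form of the coproduct. -/
lemma cgMat_mul_matJm {κ : ℝ} (hκ : 0 < κ) (i j k : ℕ) :
    cgMat κ i j k * (matK κ i (-1) ⊗ₖ matJm κ j + matJm κ i ⊗ₖ matK κ j 1)
      = matJm κ k * cgMat κ i j k := by
  have h := congrArg (fun X => X.submatrix Fin.revPerm (revSwap i j)) (cgMat_mul_matJp hκ j i k)
  simp only [← Matrix.submatrix_mul_equiv _ _ _ (revSwap i j), ← Matrix.submatrix_mul_equiv _ _ _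
    (Fin.revPerm (n := k + 1)), cgMat_submatrix] at h
  convert h using 2
  · ext ⟨a, b⟩ ⟨a', b'⟩
    simp [revSwap, matK_rev, matJp_rev]
    ring
  · ext a b
    simp [matJp_rev]

lemma cgMat_mul_rep {κ : ℝ} (hκ : 0 < κ) (i j k : ℕ) {g : UqGen}
    (hg : g = UqGen.Jp ∨ g = UqGen.Jm) :
    cgMat κ i j k * (rep κ i (Uq.gen κ UqGen.Kinv) ⊗ₖ rep κ j (Uq.gen κ g)
        + rep κ i (Uq.gen κ g) ⊗ₖ rep κ j (Uq.gen κ UqGen.K))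
      = rep κ k (Uq.gen κ g) * cgMat κ i j k := by
  rcases hg with rfl | rfl
  · simpa using cgMat_mul_matJp hκ i j k
  · simpa using cgMat_mul_matJm hκ i j k

/-- Transposition exchanges `J_+` and `J_-`, so the transposed matrix is a morphism in the opposite
direction, from `V_K` to `V_I ⊗ V_J`. -/
lemma rep_mul_cgMat_transpose {κ : ℝ} (hκ : 0 < κ) (i j k : ℕ) {g : UqGen}
    (hg : g = UqGen.Jp ∨ g = UqGen.Jm) :
    (rep κ i (Uq.gen κ UqGen.Kinv) ⊗ₖ rep κ j (Uq.gen κ g)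
        + rep κ i (Uq.gen κ g) ⊗ₖ rep κ j (Uq.gen κ UqGen.K)) * (cgMat κ i j k).transpose
      = (cgMat κ i j k).transpose * rep κ k (Uq.gen κ g) := by
  have hJ : ∀ j, (matJm κ j).transpose = matJp κ j := fun j => by
    rw [← matJp_transpose, Matrix.transpose_transpose]
  rcases hg with rfl | rfl
  · have h := congrArg Matrix.transpose (cgMat_mul_matJm hκ i j k)
    simpa only [Matrix.transpose_mul, Matrix.transpose_add, ← Matrix.kroneckerMap_transpose,
      matK_transpose, hJ, rep_K, rep_Kinv, rep_Jp] using h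
  · have h := congrArg Matrix.transpose (cgMat_mul_matJp hκ i j k)
    simpa only [Matrix.transpose_mul, Matrix.transpose_add, ← Matrix.kroneckerMap_transpose,
      matK_transpose, matJp_transpose, rep_K, rep_Kinv, rep_Jm] using h

lemma rep_K_mul_cgMat_transpose (κ : ℝ) (i j k : ℕ) :
    (rep κ i (Uq.gen κ UqGen.K) ⊗ₖ rep κ j (Uq.gen κ UqGen.K)) * (cgMat κ i j k).transpose
      = (cgMat κ i j k).transpose * rep κ k (Uq.gen κ UqGen.K) := by
  have h := congrArg Matrix.transpose (cgMat_mul_matK κ i j k 1)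
  simpa only [Matrix.transpose_mul, ← Matrix.kroneckerMap_transpose,
      matK_transpose, rep_K] using h

/-! ### Actions of the quantum double -/

lemma Uq.induction {κ : ℝ} {C : Uq κ → Prop} (hc : ∀ r : ℂ, C (algebraMap ℂ (Uq κ) r))
    (hg : ∀ g, C (Uq.gen κ g)) (hm : ∀ x y, C x → C y → C (x * y))
    (ha : ∀ x y, C x → C y → C (x + y)) (x : Uq κ) : C x := by
  obtain ⟨x, rfl⟩ := RingQuot.mkAlgHom_surjective ℂ (UqRel κ) x
  refine FreeAlgebra.induction ℂ UqGen (motive := fun x => C (Uq.mk κ x)) ?_ hg ?_ ?_ x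
  · intro r
    rw [AlgHom.commutes]
    exact hc r
  · intro a b h1 h2
    rw [map_mul]
    exact hm _ _ h1 h2
  · intro a b h1 h2
    rw [map_add]
    exact ha _ _ h1 h2

lemma Uq.comul_K (κ : ℝ) : Uq.comul κ (Uq.gen κ UqGen.K)
    = Uq.gen κ UqGen.K ⊗ₜ[ℂ] Uq.gen κ UqGen.K := Uq.lift_gen ..

lemma Uq.comul_Kinv (κ : ℝ) : Uq.comul κ (Uq.gen κ UqGen.Kinv)
    = Uq.gen κ UqGen.Kinv ⊗ₜ[ℂ] Uq.gen κ UqGen.Kinv := Uq.lift_gen ..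

lemma Uq.comul_ladder (κ : ℝ) {g : UqGen} (hg : g = UqGen.Jp ∨ g = UqGen.Jm) :
    Uq.comul κ (Uq.gen κ g) = Uq.gen κ UqGen.Kinv ⊗ₜ[ℂ] Uq.gen κ g
      + Uq.gen κ g ⊗ₜ[ℂ] Uq.gen κ UqGen.K := by
  rcases hg with rfl | rfl <;> exact Uq.lift_gen ..

lemma Uq.antipodeAux_gen (κ r : ℝ) (g : UqGen) : Uq.antipodeAux κ r (Uq.gen κ g)
    = Uq.onGen (MulOpposite.op (Uq.gen κ UqGen.Kinv)) (MulOpposite.op (Uq.gen κ UqGen.K))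
      (MulOpposite.op (-((qpow κ r : ℂ) • Uq.gen κ UqGen.Jp)))
      (MulOpposite.op (-((qpow κ (-r) : ℂ) • Uq.gen κ UqGen.Jm))) g := Uq.lift_gen ..

/-- `∑ y₍₁₎ ⊗ y₍₂₎ ⊗ y₍₃₎`. -/
def Uq.comul₃ (κ : ℝ) : Uq κ →ₐ[ℂ] Uq κ ⊗[ℂ] (Uq κ ⊗[ℂ] Uq κ) :=
  (Algebra.TensorProduct.map (AlgHom.id ℂ (Uq κ)) (Uq.comul κ)).comp (Uq.comul κ)

section Abstract

variable {κ : ℝ} {A : Type*} [Ring A] [Algebra ℂ A]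

/-- For commuting actions `ρ` and `π`, the action `b ⊗ c ↦ (X ↦ π(b) ρ(c) X)`. -/
def leftAct (ρ π : Uq κ →ₐ[ℂ] A) (h : ∀ x y, Commute (π x) (ρ y)) :
    Uq κ ⊗[ℂ] Uq κ →ₐ[ℂ] Module.End ℂ A :=
  Algebra.TensorProduct.lift ((Algebra.lmul ℂ A).comp π) ((Algebra.lmul ℂ A).comp ρ)
    fun x y => (h x y).map (Algebra.lmul ℂ A)

lemma leftAct_tmul (ρ π : Uq κ →ₐ[ℂ] A) (h : ∀ x y, Commute (π x) (ρ y)) (b c : Uq κ) (X : A) :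
    leftAct ρ π h (b ⊗ₜ c) X = π b * (ρ c * X) :=
  LinearMap.congr_fun (Algebra.TensorProduct.lift_tmul _ _ _ b c) X

/-- The action `x ↦ (X ↦ X ρ(S⁻¹ x))`. -/
def rightAct (ρ : Uq κ →ₐ[ℂ] A) : Uq κ →ₐ[ℂ] Module.End ℂ A :=
  (Algebra.lsmul ℂ ℂ A).comp ((AlgHom.op ρ).comp (Uq.antipodeAux κ (-1)))

lemma rightAct_apply (ρ : Uq κ →ₐ[ℂ] A) (a : Uq κ) (X : A) :
    rightAct ρ a X = X * ρ (Uq.antipodeInv κ a) := rfl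

/-- For commuting actions `ρ` and `π`, the algebra morphism
`a ⊗ b ⊗ c ↦ (X ↦ π(b) ρ(c) X ρ(S⁻¹ a))`. -/
def conjAct (ρ π : Uq κ →ₐ[ℂ] A) (h : ∀ x y, Commute (π x) (ρ y)) :
    Uq κ ⊗[ℂ] (Uq κ ⊗[ℂ] Uq κ) →ₐ[ℂ] Module.End ℂ A :=
  Algebra.TensorProduct.lift (rightAct ρ) (leftAct ρ π h) fun x y => by
    induction y using TensorProduct.induction_on with
    | zero => rw [map_zero]; exact Commute.zero_right _
    | tmul b c =>
      refine LinearMap.ext fun X => ?_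
      simp only [Module.End.mul_apply, leftAct_tmul, rightAct_apply, mul_assoc]
    | add y z hy hz => rw [map_add]; exact hy.add_right hz

lemma conjAct_tmul (ρ π : Uq κ →ₐ[ℂ] A) (h : ∀ x y, Commute (π x) (ρ y)) (a b c : Uq κ) (X : A) :
    conjAct ρ π h (a ⊗ₜ (b ⊗ₜ c)) X = π b * ρ c * X * ρ (Uq.antipodeInv κ a) := by
  rw [conjAct, Algebra.TensorProduct.lift_tmul, Module.End.mul_apply, leftAct_tmul, rightAct_apply]
  simp only [mul_assoc]

/-- Right multiplication by `π y` passes through since `π` commutes with `ρ`. This is what makes the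
exchange relation multiplicative in `y`. -/
lemma conjAct_mul (ρ π : Uq κ →ₐ[ℂ] A) (h : ∀ x y, Commute (π x) (ρ y))
    (t : Uq κ ⊗[ℂ] (Uq κ ⊗[ℂ] Uq κ)) (X : A) (y : Uq κ) :
    conjAct ρ π h t (X * π y) = conjAct ρ π h t X * π y := by
  induction t using TensorProduct.induction_on with
  | zero => simp
  | add s t hs ht => simp only [map_add, LinearMap.add_apply, hs, ht, add_mul]
  | tmul a t =>
    induction t using TensorProduct.induction_on with
    | zero => simp
    | add s t hs ht => simp only [TensorProduct.tmul_add, map_add, LinearMap.add_apply, hs, ht, add_mul]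
    | tmul b c => simp only [conjAct_tmul, mul_assoc, (h y _).eq]

/-- If `T` intertwines the tensor products of `ρ` and `π` in the two orders, then it satisfies the
exchange relations of the quantum double. -/
lemma conjAct_comul₃ (ρ π : Uq κ →ₐ[ℂ] A) (h : ∀ x y, Commute (π x) (ρ y)) (T : A)
    (hK : T * ρ (Uq.gen κ UqGen.K) * π (Uq.gen κ UqGen.K)
      = ρ (Uq.gen κ UqGen.K) * π (Uq.gen κ UqGen.K) * T)
    (hJ : ∀ g, g = UqGen.Jp ∨ g = UqGen.Jm →
      T * ρ (Uq.gen κ UqGen.Kinv) * π (Uq.gen κ g) + T * ρ (Uq.gen κ g) * π (Uq.gen κ UqGen.K)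
        = ρ (Uq.gen κ g) * π (Uq.gen κ UqGen.Kinv) * T
          + ρ (Uq.gen κ UqGen.K) * π (Uq.gen κ g) * T) (y : Uq κ) :
    conjAct ρ π h (Uq.comul₃ κ y) T = T * π y := by
  have r1 : ρ (Uq.gen κ UqGen.K) * ρ (Uq.gen κ UqGen.Kinv) = 1 := by
    rw [← map_mul, Uq.K_Kinv, map_one]
  have r2 : ρ (Uq.gen κ UqGen.Kinv) * ρ (Uq.gen κ UqGen.K) = 1 := by
    rw [← map_mul, Uq.Kinv_K, map_one]
  have p2 : π (Uq.gen κ UqGen.Kinv) * π (Uq.gen κ UqGen.K) = 1 := by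
    rw [← map_mul, Uq.Kinv_K, map_one]
  have p1 : π (Uq.gen κ UqGen.K) * π (Uq.gen κ UqGen.Kinv) = 1 := by
    rw [← map_mul, Uq.K_Kinv, map_one]
  -- The antipode axiom `∑ y₍₂₎ S⁻¹(y₍₁₎) = 0` for `y = J_±`, whose counit is zero.
  have ladder : ∀ g, g = UqGen.Jp ∨ g = UqGen.Jm →
      ρ (Uq.gen κ g) * ρ (Uq.gen κ UqGen.K)
        + ρ (Uq.gen κ UqGen.K) * ρ (Uq.antipodeInv κ (Uq.gen κ g)) = 0 := by
    rintro g hg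
    have : Uq.gen κ g * Uq.gen κ UqGen.K
        + Uq.gen κ UqGen.K * Uq.antipodeInv κ (Uq.gen κ g) = 0 := by
      rcases hg with rfl | rfl
      · simp only [Uq.antipodeInv, LinearMap.comp_apply, AlgHom.toLinearMap_apply,
          Uq.antipodeAux_gen, Uq.onGen, LinearEquiv.coe_coe, MulOpposite.coe_opLinearEquiv_symm,
          MulOpposite.unop_op, mul_neg, mul_smul_comm, Uq.K_mul_Jp, smul_smul, Uq.qpow_neg_mul,
          one_smul, add_neg_cancel]
      · simp only [Uq.antipodeInv, LinearMap.comp_apply, AlgHom.toLinearMap_apply,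
          Uq.antipodeAux_gen, Uq.onGen, LinearEquiv.coe_coe, MulOpposite.coe_opLinearEquiv_symm,
          MulOpposite.unop_op, mul_neg, mul_smul_comm, Uq.K_mul_Jm, smul_smul, neg_neg,
          Uq.qpow_mul_neg, one_smul, add_neg_cancel]
    rw [← map_mul, ← map_mul, ← map_add, this, map_zero]
  have aK : Uq.antipodeInv κ (Uq.gen κ UqGen.K) = Uq.gen κ UqGen.Kinv := by
    simp [Uq.antipodeInv, Uq.antipodeAux_gen, Uq.onGen]
  have aKinv : Uq.antipodeInv κ (Uq.gen κ UqGen.Kinv) = Uq.gen κ UqGen.K := by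
    simp [Uq.antipodeInv, Uq.antipodeAux_gen, Uq.onGen]
  have hladder : ∀ g, g = UqGen.Jp ∨ g = UqGen.Jm →
      conjAct ρ π h (Uq.comul₃ κ (Uq.gen κ g)) T = T * π (Uq.gen κ g) := by
    intro g hg
    simp only [Uq.comul₃, AlgHom.comp_apply, Uq.comul_ladder κ hg, map_add,
      Algebra.TensorProduct.map_tmul, AlgHom.id_apply, Uq.comul_K, TensorProduct.tmul_add,
      LinearMap.add_apply, conjAct_tmul, aKinv]
    -- Of the three terms of the iterated coproduct, the two ending in `S⁻¹(q^{-J_z})` combine by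
    -- `hJ`, and the third is rewritten by `hK`. Beyond `T * π g` there remains a multiple of the
    -- expression in `ladder`.
    rw [(h _ _).eq, (h _ _).eq, (h _ _).eq, ← add_mul, ← hJ g hg, ← hK]
    simp only [add_mul, mul_assoc, (h _ _).eq]
    rw [← mul_assoc (ρ (Uq.gen κ UqGen.Kinv)), r2, one_mul, add_assoc, ← mul_add,
      ← mul_assoc (ρ (Uq.gen κ g)), ← mul_assoc (ρ (Uq.gen κ UqGen.K)), ← add_mul, ladder g hg,
      zero_mul, mul_zero, add_zero]
  -- By `conjAct_mul` the relation for `x` and `y` implies it for `x * y`, so only generators need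
  -- computation.
  induction y using Uq.induction with
  | hc r => simp [Algebra.algebraMap_eq_smul_one]
  | ha x y hx hy => simp only [map_add, LinearMap.add_apply, hx, hy, mul_add]
  | hm x y hx hy =>
    rw [map_mul, map_mul, Module.End.mul_apply, hy, conjAct_mul, hx, map_mul, mul_assoc]
  | hg g =>
    cases g with
    | Jp => exact hladder _ (Or.inl rfl)
    | Jm => exact hladder _ (Or.inr rfl)
    | K =>
      simp only [Uq.comul₃, AlgHom.comp_apply, Uq.comul_K,
        Algebra.TensorProduct.map_tmul, AlgHom.id_apply, conjAct_tmul, aK]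
      rw [(h _ _).eq, ← hK, mul_assoc, (h _ _).eq, ← mul_assoc, mul_assoc T, r1, mul_one]
    | Kinv =>
      have hK' : ρ (Uq.gen κ UqGen.Kinv) * π (Uq.gen κ UqGen.Kinv) * T
          = T * ρ (Uq.gen κ UqGen.Kinv) * π (Uq.gen κ UqGen.Kinv) := by
        have e : ρ (Uq.gen κ UqGen.K) * π (Uq.gen κ UqGen.K)
            * (ρ (Uq.gen κ UqGen.Kinv) * π (Uq.gen κ UqGen.Kinv)) = 1 := by
          rw [mul_assoc, ← mul_assoc (π _), (h _ _).eq, mul_assoc (ρ _) (π _), p1, mul_one, r1]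
        have e' : ρ (Uq.gen κ UqGen.Kinv) * π (Uq.gen κ UqGen.Kinv)
            * (ρ (Uq.gen κ UqGen.K) * π (Uq.gen κ UqGen.K)) = 1 := by
          rw [mul_assoc, ← mul_assoc (π _), (h _ _).eq, mul_assoc (ρ _) (π _), p2, mul_one, r2]
        calc _ = ρ (Uq.gen κ UqGen.Kinv) * π (Uq.gen κ UqGen.Kinv) * (T
              * (ρ (Uq.gen κ UqGen.K) * π (Uq.gen κ UqGen.K)
                * (ρ (Uq.gen κ UqGen.Kinv) * π (Uq.gen κ UqGen.Kinv)))) := by rw [e, mul_one]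
          _ = ρ (Uq.gen κ UqGen.Kinv) * π (Uq.gen κ UqGen.Kinv) * ((T
              * ρ (Uq.gen κ UqGen.K) * π (Uq.gen κ UqGen.K))
                * (ρ (Uq.gen κ UqGen.Kinv) * π (Uq.gen κ UqGen.Kinv))) := by
              simp only [mul_assoc]
          _ = (ρ (Uq.gen κ UqGen.Kinv) * π (Uq.gen κ UqGen.Kinv)
              * (ρ (Uq.gen κ UqGen.K) * π (Uq.gen κ UqGen.K))) * (T * ρ (Uq.gen κ UqGen.Kinv)
                * π (Uq.gen κ UqGen.Kinv)) := by rw [hK]; simp only [mul_assoc]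
          _ = _ := by rw [e', one_mul]
      simp only [Uq.comul₃, AlgHom.comp_apply, Uq.comul_Kinv,
        Algebra.TensorProduct.map_tmul, AlgHom.id_apply, conjAct_tmul, aKinv]
      rw [(h _ _).eq, hK', mul_assoc, (h _ _).eq, ← mul_assoc, mul_assoc T, r2, mul_one]

end Abstract

/-! ### The exchange relation and the antipode in the principal representations -/

lemma actUq_e (κ : ℝ) {n : ℤ} (x : Uq κ) (k : ℕ) (a : Fin (n.natAbs + 2 * k + 1)) :
    actUq κ n x (e ⟨k, a⟩) = ∑ b, rep κ (n.natAbs + 2 * k) x b a • e (⟨k, b⟩ : VIdx n) := by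
  simp [actUq, e]

lemma V_ext {n : ℤ} {M : Type*} [AddCommGroup M] [Module ℂ M] {f g : V n →ₗ[ℂ] M}
    (h : ∀ k (a : Fin (n.natAbs + 2 * k + 1)), f (e ⟨k, a⟩) = g (e ⟨k, a⟩)) : f = g :=
  Finsupp.lhom_ext' fun ⟨k, a⟩ => LinearMap.ext_ring (h k a)

/-- The action of `U_q(su(2))` on `V_α` as an algebra morphism. -/
def actUqHom (κ : ℝ) (n : ℤ) : Uq κ →ₐ[ℂ] Module.End ℂ (V n) :=
  AlgHom.ofLinearMap (actUq κ n)
    (V_ext fun k a => by simp [actUq_e, Matrix.one_apply])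
    fun x y => V_ext fun k a => by
      simp only [actUq_e, Module.End.mul_apply, map_sum, map_smul, map_mul, Matrix.mul_apply,
        Finset.smul_sum, smul_smul, Finset.sum_smul]
      rw [Finset.sum_comm]
      simp only [mul_comm]

/-- The matrix of the intertwiner `V_J ⊗ V_L → V_N ⊗ V_J` which defines the action of the
matrix elements `u_J`. -/
def twist (κ : ℝ) (n : ℤ) (p : ℝ) (J N L : ℕ) :
    Matrix (Fin (N + 1) × Fin (J + 1)) (Fin (J + 1) × Fin (L + 1)) ℂ :=
  ∑ M ∈ Finset.range (J + L + 1),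
    lambda κ n p J M N L • ((cgMat κ N J M).transpose * cgMat κ J L M)

lemma twist_mul_K (κ : ℝ) (n : ℤ) (p : ℝ) (J N L : ℕ) :
    twist κ n p J N L * (rep κ J (Uq.gen κ UqGen.K) ⊗ₖ rep κ L (Uq.gen κ UqGen.K))
      = (rep κ N (Uq.gen κ UqGen.K) ⊗ₖ rep κ J (Uq.gen κ UqGen.K)) * twist κ n p J N L := by
  simp only [twist, Matrix.sum_mul, Matrix.mul_sum, Matrix.smul_mul, Matrix.mul_smul]
  refine Finset.sum_congr rfl fun M _ => ?_
  rw [← Matrix.mul_assoc, rep_K_mul_cgMat_transpose, Matrix.mul_assoc, Matrix.mul_assoc]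
  simp only [rep_K, cgMat_mul_matK]

/-- Each summand factors through `V_M` by two morphisms of `U_q(su(2))`-modules, so the weights `Λ`
play no role. -/
lemma twist_mul_ladder {κ : ℝ} (hκ : 0 < κ) (n : ℤ) (p : ℝ) (J N L : ℕ) {g : UqGen}
    (hg : g = UqGen.Jp ∨ g = UqGen.Jm) :
    twist κ n p J N L * (rep κ J (Uq.gen κ UqGen.Kinv) ⊗ₖ rep κ L (Uq.gen κ g)
        + rep κ J (Uq.gen κ g) ⊗ₖ rep κ L (Uq.gen κ UqGen.K))
      = (rep κ N (Uq.gen κ UqGen.Kinv) ⊗ₖ rep κ J (Uq.gen κ g)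
        + rep κ N (Uq.gen κ g) ⊗ₖ rep κ J (Uq.gen κ UqGen.K)) * twist κ n p J N L := by
  simp only [twist, Matrix.sum_mul, Matrix.mul_sum, Matrix.smul_mul, Matrix.mul_smul]
  refine Finset.sum_congr rfl fun M _ => ?_
  rw [← Matrix.mul_assoc, rep_mul_cgMat_transpose hκ _ _ _ hg, Matrix.mul_assoc, Matrix.mul_assoc,
    cgMat_mul_rep hκ _ _ _ hg]

lemma actFq_u_e (κ : ℝ) (n : ℤ) (p : ℝ) (J : ℕ) (r r' : Fin (J + 1)) (l : ℕ)
    (a : Fin (n.natAbs + 2 * l + 1)) :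
    actFq κ n p (Fq.u J r r') (e ⟨l, a⟩)
      = ∑ k ∈ Finset.range (l + J + 1), ∑ b : Fin (n.natAbs + 2 * k + 1),
        twist κ n p J (n.natAbs + 2 * k) (n.natAbs + 2 * l) (b, r) (r', a)
          • e (⟨k, b⟩ : VIdx n) := by
  simp only [actFq, Fq.u, Module.Basis.constr_basis, e, Finsupp.linearCombination_single, one_smul]
  refine Finset.sum_congr rfl fun k _ => Finset.sum_congr rfl fun b _ => ?_
  simp only [twist, Matrix.sum_apply, Matrix.smul_apply, Matrix.mul_apply, Matrix.transpose_apply,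
    cgMat, Matrix.of_apply, Finset.sum_smul, smul_eq_mul, Finset.mul_sum]
  refine Finset.sum_congr rfl fun M _ => Finset.sum_congr rfl fun m _ => ?_
  push_cast
  ring_nf

/-- The matrix `(π_α(u_J{}^m{}_n))`. -/
def uMat (κ : ℝ) (n : ℤ) (p : ℝ) (J : ℕ) :
    Matrix (Fin (J + 1)) (Fin (J + 1)) (Module.End ℂ (V n)) :=
  Matrix.of fun r r' => actFq κ n p (Fq.u J r r')

/-- The representation `π_J` as matrices of scalar endomorphisms. -/
def repEnd (κ : ℝ) (n : ℤ) (J : ℕ) :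
    Uq κ →ₐ[ℂ] Matrix (Fin (J + 1)) (Fin (J + 1)) (Module.End ℂ (V n)) :=
  (AlgHom.mapMatrix (Algebra.ofId ℂ (Module.End ℂ (V n)))).comp (rep κ J)

/-- The action on `V_α` as diagonal matrices. -/
def actDiag (κ : ℝ) (n : ℤ) (J : ℕ) :
    Uq κ →ₐ[ℂ] Matrix (Fin (J + 1)) (Fin (J + 1)) (Module.End ℂ (V n)) :=
  (Matrix.scalarAlgHom (Fin (J + 1)) ℂ).comp (actUqHom κ n)

lemma repEnd_apply (κ : ℝ) (n : ℤ) (J : ℕ) (x : Uq κ) (r r' : Fin (J + 1)) :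
    repEnd κ n J x r r' = algebraMap ℂ (Module.End ℂ (V n)) (rep κ J x r r') := rfl

lemma actDiag_apply (κ : ℝ) (n : ℤ) (J : ℕ) (x : Uq κ) :
    actDiag κ n J x = Matrix.diagonal fun _ => actUq κ n x := rfl

lemma actDiag_commute (κ : ℝ) (n : ℤ) (J : ℕ) (x y : Uq κ) :
    Commute (actDiag κ n J x) (repEnd κ n J y) := by
  refine Matrix.ext fun r r' => ?_
  rw [actDiag_apply, Matrix.diagonal_mul, Matrix.mul_diagonal, repEnd_apply]
  exact (Algebra.commutes _ _).symm

lemma sum_rotate {ι κ₁ M : Type*} {κ₂ : κ₁ → Type*} [AddCommMonoid M] (s : Finset ι)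
    (t : Finset κ₁) (u : ∀ y, Finset (κ₂ y)) (F : ι → ∀ y, κ₂ y → M) :
    ∑ x ∈ s, ∑ y ∈ t, ∑ z ∈ u y, F x y z = ∑ y ∈ t, ∑ z ∈ u y, ∑ x ∈ s, F x y z := by
  rw [Finset.sum_comm]
  exact Finset.sum_congr rfl fun y _ => Finset.sum_comm

/-- Together with `mul_uMat_e`, this reduces operator identities on the infinite-dimensional `V_α`
to identities between finite matrices `twist`. -/
lemma uMat_mul_e (κ : ℝ) (n : ℤ) (p : ℝ) (J : ℕ) (x y : Uq κ) (r r' : Fin (J + 1)) (l : ℕ)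
    (a : Fin (n.natAbs + 2 * l + 1)) :
    (uMat κ n p J * repEnd κ n J x * actDiag κ n J y) r r' (e ⟨l, a⟩)
      = ∑ k ∈ Finset.range (l + J + 1), ∑ b : Fin (n.natAbs + 2 * k + 1),
        (twist κ n p J (n.natAbs + 2 * k) (n.natAbs + 2 * l)
          * (rep κ J x ⊗ₖ rep κ (n.natAbs + 2 * l) y)) (b, r) (r', a) • e (⟨k, b⟩ : VIdx n) := by
  rw [actDiag_apply, Matrix.mul_diagonal, Module.End.mul_apply, actUq_e, Matrix.mul_apply]
  simp only [LinearMap.sum_apply, map_sum, map_smul, Module.End.mul_apply, repEnd_apply, uMat,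
    Matrix.of_apply, Module.algebraMap_end_apply, actFq_u_e, Finset.smul_sum, Matrix.mul_apply,
    Finset.sum_smul, smul_smul, Fintype.sum_prod_type, Matrix.kroneckerMap_apply]
  refine (Finset.sum_congr rfl fun _ _ => sum_rotate ..).trans ?_
  rw [sum_rotate]
  refine Finset.sum_congr rfl fun k _ => Finset.sum_congr rfl fun b _ => ?_
  rw [Finset.sum_comm]
  refine Finset.sum_congr rfl fun i _ => Finset.sum_congr rfl fun c _ => ?_
  ring_nf

lemma mul_uMat_e (κ : ℝ) (n : ℤ) (p : ℝ) (J : ℕ) (x y : Uq κ) (r r' : Fin (J + 1)) (l : ℕ)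
    (a : Fin (n.natAbs + 2 * l + 1)) :
    (repEnd κ n J y * actDiag κ n J x * uMat κ n p J) r r' (e ⟨l, a⟩)
      = ∑ k ∈ Finset.range (l + J + 1), ∑ b : Fin (n.natAbs + 2 * k + 1),
        ((rep κ (n.natAbs + 2 * k) x ⊗ₖ rep κ J y)
          * twist κ n p J (n.natAbs + 2 * k) (n.natAbs + 2 * l)) (b, r) (r', a)
            • e (⟨k, b⟩ : VIdx n) := by
  rw [← (actDiag_commute κ n J x y).eq, mul_assoc, actDiag_apply, Matrix.diagonal_mul,
    Module.End.mul_apply, Matrix.mul_apply]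
  simp only [LinearMap.sum_apply, map_sum, map_smul, Module.End.mul_apply, repEnd_apply, uMat,
    Matrix.of_apply, Module.algebraMap_end_apply, actFq_u_e, actUq_e, Finset.smul_sum,
    Matrix.mul_apply,
    Finset.sum_smul, smul_smul, Fintype.sum_prod_type, Matrix.kroneckerMap_apply]
  rw [sum_rotate]
  refine Finset.sum_congr rfl fun k _ => ?_
  rw [Finset.sum_congr rfl fun _ _ => Finset.sum_comm, Finset.sum_comm]
  refine Finset.sum_congr rfl fun b _ => Finset.sum_congr rfl fun c _ => ?_
  refine Finset.sum_congr rfl fun i _ => ?_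
  ring_nf

/-- The morphism property of `twist` supplies the hypotheses of `conjAct_comul₃`, with `π_J` as
scalar matrices in the role of `ρ` and the diagonal action on `V_α` in the role of `π`. -/
lemma uMat_exchange {κ : ℝ} (hκ : 0 < κ) (n : ℤ) (p : ℝ) (J : ℕ) (y : Uq κ) :
    conjAct (repEnd κ n J) (actDiag κ n J) (actDiag_commute κ n J) (Uq.comul₃ κ y) (uMat κ n p J)
      = uMat κ n p J * actDiag κ n J y := by
  have hK : uMat κ n p J * repEnd κ n J (Uq.gen κ UqGen.K) * actDiag κ n J (Uq.gen κ UqGen.K)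
      = repEnd κ n J (Uq.gen κ UqGen.K) * actDiag κ n J (Uq.gen κ UqGen.K) * uMat κ n p J := by
    refine Matrix.ext fun r r' => V_ext fun l a => ?_
    rw [uMat_mul_e, mul_uMat_e]
    simp only [twist_mul_K]
  have hJ : ∀ g, g = UqGen.Jp ∨ g = UqGen.Jm →
      uMat κ n p J * repEnd κ n J (Uq.gen κ UqGen.Kinv) * actDiag κ n J (Uq.gen κ g)
        + uMat κ n p J * repEnd κ n J (Uq.gen κ g) * actDiag κ n J (Uq.gen κ UqGen.K)
      = repEnd κ n J (Uq.gen κ g) * actDiag κ n J (Uq.gen κ UqGen.Kinv) * uMat κ n p J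
        + repEnd κ n J (Uq.gen κ UqGen.K) * actDiag κ n J (Uq.gen κ g) * uMat κ n p J := by
    intro g hg
    refine Matrix.ext fun r r' => V_ext fun l a => ?_
    rw [Matrix.add_apply, Matrix.add_apply, LinearMap.add_apply, LinearMap.add_apply,
      uMat_mul_e, mul_uMat_e, uMat_mul_e, mul_uMat_e]
    simp only [← Finset.sum_add_distrib, ← add_smul, ← Matrix.add_apply, ← Matrix.mul_add,
      ← Matrix.add_mul, twist_mul_ladder hκ _ _ _ _ _ hg]
  exact conjAct_comul₃ _ _ _ _ hK hJ y

lemma principal_tmul (κ : ℝ) (n : ℤ) (p : ℝ) (x : Uq κ) (f : Fq) :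
    principal κ n p (x ⊗ₜ f) = actUq κ n x * actFq κ n p f := by
  simp [principal]

lemma Uq.sandwich_eq (κ : ℝ) (φ ψ : Uq κ →ₗ[ℂ] ℂ) (y : Uq κ) :
    Uq.sandwich κ φ ψ y = TensorProduct.lid ℂ (Uq κ) (TensorProduct.map φ
      ((TensorProduct.rid ℂ (Uq κ)).toLinearMap ∘ₗ TensorProduct.map LinearMap.id ψ)
      (Uq.comul₃ κ y)) := by
  have h : ∀ t : Uq κ ⊗[ℂ] Uq κ, TensorProduct.map φ ((TensorProduct.rid ℂ (Uq κ)).toLinearMap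
        ∘ₗ TensorProduct.map LinearMap.id ψ ∘ₗ (Uq.comul κ).toLinearMap) t
      = TensorProduct.map φ
        ((TensorProduct.rid ℂ (Uq κ)).toLinearMap ∘ₗ TensorProduct.map LinearMap.id ψ)
        (Algebra.TensorProduct.map (AlgHom.id ℂ (Uq κ)) (Uq.comul κ) t) := by
    intro t
    induction t using TensorProduct.induction_on with
    | zero => simp
    | add s t hs ht => simp only [map_add, hs, ht]
    | tmul a b => simp
  exact congrArg (TensorProduct.lid ℂ (Uq κ)) (h _)

/-- Matrix multiplication on the two sides of `X` produces the two pairings of the exchange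
relation: `y₍₃₎` on the left, `S⁻¹(y₍₁₎)` on the right. -/
lemma conjAct_apply (κ : ℝ) (n : ℤ) (J : ℕ)
    (X : Matrix (Fin (J + 1)) (Fin (J + 1)) (Module.End ℂ (V n))) (m m' : Fin (J + 1))
    (t : Uq κ ⊗[ℂ] (Uq κ ⊗[ℂ] Uq κ)) :
    conjAct (repEnd κ n J) (actDiag κ n J) (actDiag_commute κ n J) t X m m'
      = ∑ k, ∑ l, actUq κ n (TensorProduct.lid ℂ (Uq κ) (TensorProduct.map
          (Fq.pairing κ J l m' ∘ₗ Uq.antipodeInv κ)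
          ((TensorProduct.rid ℂ (Uq κ)).toLinearMap
            ∘ₗ TensorProduct.map LinearMap.id (Fq.pairing κ J m k)) t)) * X k l := by
  induction t using TensorProduct.induction_on with
  | zero => simp
  | add s t hs ht =>
    simp only [map_add, LinearMap.add_apply, Matrix.add_apply, hs, ht, add_mul,
      Finset.sum_add_distrib]
  | tmul a t =>
    induction t using TensorProduct.induction_on with
    | zero => simp
    | add s t hs ht =>
      simp only [TensorProduct.tmul_add, map_add, LinearMap.add_apply, Matrix.add_apply, hs, ht,
        add_mul, Finset.sum_add_distrib]
    | tmul b c =>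
      rw [conjAct_tmul, Matrix.mul_apply, Finset.sum_comm]
      refine Finset.sum_congr rfl fun l _ => ?_
      rw [mul_assoc, actDiag_apply, Matrix.diagonal_mul, Matrix.mul_apply, Finset.mul_sum,
        Finset.sum_mul]
      refine Finset.sum_congr rfl fun k _ => ?_
      simp only [repEnd_apply, Fq.pairing, TensorProduct.map_tmul, LinearMap.comp_apply,
        LinearEquiv.coe_coe, TensorProduct.rid_tmul, TensorProduct.lid_tmul, map_smul,
        LinearMap.id_apply, AlgHom.toLinearMap_apply, Matrix.entryLinearMap_apply,
        Algebra.algebraMap_eq_smul_one, smul_mul_assoc, mul_smul_comm, one_mul, mul_one]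

/-- The exchange relation of the quantum double holds in the principal representations. -/
lemma principal_exchange {κ : ℝ} (hκ : 0 < κ) (n : ℤ) (p : ℝ) (f : Fq) (y : Uq κ) :
    principal κ n p (QLG.exchange κ f y) = actFq κ n p f * actUq κ n y := by
  have h : principal κ n p ∘ₗ (QLG.exchange κ).flip y
      = LinearMap.mulRight ℂ (actUq κ n y) ∘ₗ actFq κ n p := by
    refine Fq.basis.ext fun ⟨J, m, m'⟩ => ?_
    have h := congrArg (fun X => X m m') (uMat_exchange hκ n p J y)
    simp only [conjAct_apply, actDiag_apply, Matrix.mul_diagonal] at h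
    simp only [LinearMap.comp_apply, LinearMap.flip_apply, QLG.exchange,
      Module.Basis.constr_basis, LinearMap.sum_apply, map_sum, LinearMap.mulRight_apply,
      TensorProduct.mk_apply, principal_tmul, Uq.sandwich_eq]
    exact h
  exact LinearMap.congr_fun h f

lemma Fq.mul_one {κ : ℝ} (hκ : 0 < κ) (f : Fq) : Fq.mul κ f Fq.one = f := by
  have h : (Fq.mul κ).flip Fq.one = LinearMap.id := by
    refine Fq.basis.ext fun ⟨J, m, m'⟩ => ?_
    simp only [LinearMap.flip_apply, Fq.mul, Module.Basis.constr_basis, Fq.one, Fq.u,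
      LinearMap.id_apply]
    rw [Finset.sum_eq_single J]
    · simp only [Fin.val_zero, cg_zero_right hκ (Nat.lt_succ_iff.1 (Fin.is_lt _)),
        Fin.val_inj]
      simp
    · intro K _ hK
      refine Finset.sum_eq_zero fun r _ => Finset.sum_eq_zero fun s _ => ?_
      have : cg κ J 0 K m 0 r = 0 := by
        by_contra h
        obtain ⟨s, h⟩ := exists_triangle_of_cg_ne_zero h
        omega
      simp [this]
    · simp
  exact LinearMap.congr_fun h f

/-- The principal representations and the antipode of the quantum double. -/
lemma principal_antipode_tmul {κ : ℝ} (hκ : 0 < κ) (n : ℤ) (p : ℝ) (x : Uq κ) (f : Fq) :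
    principal κ n p (QLG.antipode κ (x ⊗ₜ f))
      = actFq κ n p (Fq.antipodeInv κ f) * actUq κ n (Uq.antipode κ x) := by
  rw [← principal_exchange hκ]
  congr 1
  simp only [QLG.antipode, QLG.mul, QLG.ofFq, QLG.ofUq, LinearMap.comp_apply, LinearEquiv.coe_coe,
    TensorProduct.comm_tmul, TensorProduct.map_tmul, TensorProduct.mk_apply, LinearMap.flip_apply,
    TensorProduct.assoc_tmul, LinearMap.lTensor_tmul, TensorProduct.assoc_symm_tmul,
    LinearMap.rTensor_tmul, TensorProduct.lift.tmul]
  -- Only units flank the exchanged element: `1` on the left in `U_q(su(2))` and `1` on the right in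
  -- `F_q(SU(2))`.
  generalize QLG.exchange κ (Fq.antipodeInv κ f) (Uq.antipode κ x) = t
  induction t using TensorProduct.induction_on with
  | zero => simp
  | add s t hs ht => simp only [TensorProduct.add_tmul, TensorProduct.tmul_add, map_add, hs, ht]
  | tmul a g => simp [Fq.mul_one hκ]

/-! ### The matrix `ε` -/

/-- The nonzero entries of `ε`. -/
def epsVal (κ : ℝ) (j a : ℕ) : ℂ :=
  (-1) ^ a * (qpow κ ((j : ℝ) / 2 * ((j : ℝ) / 2 + 1)) : ℂ)
    * (qpow κ (-((a : ℝ) - (j : ℝ) / 2)) : ℂ)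

lemma qpow_ofReal_ne_zero (κ x : ℝ) : (qpow κ x : ℂ) ≠ 0 :=
  Complex.ofReal_ne_zero.2 (qpow_pos κ x).ne'

lemma epsVal_ne_zero (κ : ℝ) (j a : ℕ) : epsVal κ j a ≠ 0 :=
  mul_ne_zero (mul_ne_zero (pow_ne_zero _ (by norm_num)) (qpow_ofReal_ne_zero _ _))
    (qpow_ofReal_ne_zero _ _)

lemma epsVal_succ (κ : ℝ) (j a : ℕ) :
    epsVal κ j (a + 1) = -((qpow κ (-1) : ℂ) * epsVal κ j a) := by
  rw [epsVal, epsVal, show -(((a + 1 : ℕ) : ℝ) - (j : ℝ) / 2) = -1 + -((a : ℝ) - (j : ℝ) / 2) by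
    push_cast; ring, qpow_add]
  push_cast
  ring

lemma eps_apply (κ : ℝ) (j : ℕ) (a b : Fin (j + 1)) :
    Fq.eps κ j a b = if a = b.rev then epsVal κ j a else 0 := by
  refine if_congr ?_ rfl rfl
  rw [Fin.ext_iff, Fin.val_rev]
  omega

lemma eps_mul_apply (κ : ℝ) (j : ℕ) (X : Matrix (Fin (j + 1)) (Fin (j + 1)) ℂ)
    (a b : Fin (j + 1)) : (Fq.eps κ j * X) a b = epsVal κ j a * X a.rev b := by
  rw [Matrix.mul_apply, Finset.sum_eq_single a.rev]
  · simp [eps_apply]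
  · intro c _ hc
    rw [eps_apply, if_neg, zero_mul]
    rintro rfl
    exact hc (Fin.rev_rev c).symm
  · simp

lemma mul_eps_apply (κ : ℝ) (j : ℕ) (X : Matrix (Fin (j + 1)) (Fin (j + 1)) ℂ)
    (a b : Fin (j + 1)) : (X * Fq.eps κ j) a b = X a b.rev * epsVal κ j b.rev := by
  rw [Matrix.mul_apply, Finset.sum_eq_single b.rev]
  · simp [eps_apply]
  · intro c _ hc
    rw [eps_apply, if_neg hc, mul_zero]
  · simp

lemma eps_inv_apply (κ : ℝ) (j : ℕ) (a b : Fin (j + 1)) :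
    (Fq.eps κ j)⁻¹ a b = if b = a.rev then (epsVal κ j b)⁻¹ else 0 := by
  have h : Fq.eps κ j * Matrix.of (fun a b : Fin (j + 1) => if b = a.rev then (epsVal κ j b)⁻¹ else 0) = 1 := by
    ext a b
    rw [eps_mul_apply, Matrix.of_apply, Fin.rev_rev, Matrix.one_apply]
    by_cases h : b = a
    · rw [if_pos h, if_pos h.symm, h, mul_inv_cancel₀ (epsVal_ne_zero κ j a)]
    · rw [if_neg h, if_neg (Ne.symm h), mul_zero]
  rw [Matrix.inv_eq_right_inv h, Matrix.of_apply]

lemma antipodeInv_u (κ : ℝ) (J : ℕ) (r r' : Fin (J + 1)) :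
    Fq.antipodeInv κ (Fq.u J r r')
      = ((epsVal κ J r.rev)⁻¹ * epsVal κ J r'.rev) • Fq.u J r'.rev r.rev := by
  simp only [Fq.antipodeInv, Fq.u, Module.Basis.constr_basis]
  simp [eps_inv_apply, eps_apply]

/-- `ε` intertwines `π_I` and its contragredient. -/
lemma eps_mul_rep (κ : ℝ) (j : ℕ) (x : Uq κ) :
    Fq.eps κ j * rep κ j x = (rep κ j (Uq.antipode κ x)).transpose * Fq.eps κ j := by
  induction x using Uq.induction with
  | hc r =>
    have : Uq.antipode κ (algebraMap ℂ (Uq κ) r) = algebraMap ℂ (Uq κ) r := by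
      simp [Uq.antipode]
    rw [this, AlgHom.commutes, Matrix.algebraMap_eq_diagonal, Matrix.diagonal_transpose]
    ext a b
    rw [Matrix.mul_diagonal, Matrix.diagonal_mul]
    exact mul_comm _ _
  | ha x y hx hy => rw [map_add, map_add, map_add, mul_add, hx, hy, Matrix.transpose_add, add_mul]
  | hm x y hx hy =>
    have : Uq.antipode κ (x * y) = Uq.antipode κ y * Uq.antipode κ x := by
      simp [Uq.antipode]
    rw [this, map_mul, map_mul, ← mul_assoc, hx, mul_assoc, hy, Matrix.transpose_mul, mul_assoc]
  | hg g =>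
    have hS : Uq.antipode κ (Uq.gen κ g) = Uq.onGen (Uq.gen κ UqGen.Kinv) (Uq.gen κ UqGen.K)
        (-((qpow κ 1 : ℂ) • Uq.gen κ UqGen.Jp)) (-((qpow κ (-1) : ℂ) • Uq.gen κ UqGen.Jm)) g := by
      cases g <;> simp only [Uq.antipode, LinearMap.comp_apply, AlgHom.toLinearMap_apply,
        Uq.antipodeAux_gen, Uq.onGen, LinearEquiv.coe_coe, MulOpposite.coe_opLinearEquiv_symm,
        MulOpposite.unop_op]
    rw [hS]
    ext a b
    rw [eps_mul_apply, mul_eps_apply]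
    cases g with
    | K =>
      simp only [Uq.onGen, rep_K, rep_Kinv, matK_transpose]
      rw [← matK_rev κ j 1, Fin.rev_rev]
      by_cases h : a = b.rev
      · rw [h]; ring
      · rw [matK, Matrix.diagonal_apply_ne _ (fun h' => h (by rw [← h', Fin.rev_rev]))]
        ring
    | Kinv =>
      simp only [Uq.onGen, rep_K, rep_Kinv, matK_transpose]
      rw [← neg_neg (1 : ℝ), neg_neg (-(1 : ℝ)), ← matK_rev κ j (-1), Fin.rev_rev]
      by_cases h : a = b.rev
      · rw [h]; ring
      · rw [matK, Matrix.diagonal_apply_ne _ (fun h' => h (by rw [← h', Fin.rev_rev]))]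
        ring
    | Jp =>
      simp only [Uq.onGen, map_neg, map_smul, rep_Jp, Matrix.transpose_neg, Matrix.transpose_smul,
        matJp_transpose, Matrix.neg_apply, Matrix.smul_apply, smul_eq_mul]
      rw [← Fin.rev_rev b, matJp_rev, Fin.rev_rev]
      -- Consecutive entries of `ε` have ratio `-q⁻¹`, which compensates the factor in `S(J_+) = -q
      -- J_+`.
      by_cases h : (b.rev : ℕ) = a + 1
      · rw [h, epsVal_succ]
        linear_combination (-(epsVal κ j a * matJm κ j a b.rev)) * Uq.qpow_mul_neg κ
      · rw [matJm, Matrix.of_apply, if_neg h]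
        ring
    | Jm =>
      simp only [Uq.onGen, map_neg, map_smul, rep_Jm, Matrix.transpose_neg, Matrix.transpose_smul,
        Matrix.neg_apply, Matrix.smul_apply, smul_eq_mul, ← matJp_transpose, Matrix.transpose_transpose]
      rw [← Fin.rev_rev b, Matrix.transpose_apply, matJp_rev, ← matJp_transpose,
        Matrix.transpose_apply, Fin.rev_rev]
      by_cases h : (a : ℕ) = b.rev + 1
      · rw [h, epsVal_succ]
        ring
      · rw [matJp, Matrix.of_apply, if_neg h]
        ring

/-! ### Symmetry of the intertwiners -/

/-- `N` and `L` enter only through a product of two like factors. The equality is one of functions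
of `t`, so it passes to the limit in `lambda`. -/
lemma lambdaSum_swap (κ : ℝ) (n : ℤ) (J M N L : ℕ) :
    lambdaSum κ n J M L N = lambdaSum κ n J M N L := by
  funext t
  rw [lambdaSum, lambdaSum, mul_comm (sixJNorm κ n (Complex.I * t / 2) J M L : ℂ)]
  congr 1
  refine Finset.sum_congr rfl fun r _ => ?_
  ring

lemma lambda_swap (κ : ℝ) (n : ℤ) (p : ℝ) (J M N L : ℕ) :
    (-1) ^ ((L + J - M) / 2) * lambda κ n p J M N L
      = (-1) ^ ((N + J - M) / 2) * lambda κ n p J M L N := by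
  rw [lambda, lambda, lambdaSum_swap, add_comm L N, add_comm ((L : ℝ) / 2 * ((L : ℝ) / 2 + 1))]
  ring

lemma neg_one_pow_congr_mod {a b : ℕ} (h : a % 2 = b % 2) : (-1 : ℂ) ^ a = (-1) ^ b := by
  rw [neg_one_pow_eq_pow_mod_two, h, ← neg_one_pow_eq_pow_mod_two]

/-- The range of `M` is enlarged to be symmetric in `N` and `L`, so that `twist_swap` can compare
term by term; the triangle condition kills the added terms. -/
lemma twist_apply (κ : ℝ) (n : ℤ) (p : ℝ) (J N L : ℕ) (b : Fin (N + 1)) (r r' : Fin (J + 1))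
    (a : Fin (L + 1)) :
    twist κ n p J N L (b, r) (r', a) = ∑ M ∈ Finset.range (J + L + N + 1), ∑ m : Fin (M + 1),
      lambda κ n p J M N L * ((cg κ N J M b r m * cg κ J L M r' a m : ℝ) : ℂ) := by
  rw [twist, Matrix.sum_apply]
  refine Finset.sum_subset_zero_on_sdiff (Finset.range_mono (by omega)) ?_ ?_
  · intro M hM
    rw [Finset.mem_sdiff, Finset.mem_range, Finset.mem_range] at hM
    refine Finset.sum_eq_zero fun m _ => ?_
    have : cg κ J L M r' a m = 0 := by
      by_contra h
      obtain ⟨s, h⟩ := exists_triangle_of_cg_ne_zero h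
      omega
    simp [this]
  · intro M _
    simp [Matrix.mul_apply, cgMat, Finset.mul_sum]

/-- Two triangle conditions give `N ≤ M + J ≤ L + 2 * J`. Hence the finite range in `actFq` omits no
nonzero term. -/
lemma twist_eq_zero (κ : ℝ) (n : ℤ) (p : ℝ) {J N L : ℕ} (h : L + 2 * J < N)
    (b : Fin (N + 1)) (r r' : Fin (J + 1)) (a : Fin (L + 1)) :
    twist κ n p J N L (b, r) (r', a) = 0 := by
  rw [twist_apply]
  refine Finset.sum_eq_zero fun M _ => Finset.sum_eq_zero fun m _ => ?_
  by_cases h1 : cg κ N J M b r m = 0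
  · simp [h1]
  · by_cases h2 : cg κ J L M r' a m = 0
    · simp [h2]
    · obtain ⟨s, h3⟩ := exists_triangle_of_cg_ne_zero h1
      obtain ⟨t, h4⟩ := exists_triangle_of_cg_ne_zero h2
      omega

/-- The value of the invariant form on `e^I_m`, `e^I_{-m}`, `m = a - I`. -/
def formVal (κ : ℝ) (c : ℂ) (j a : ℕ) : ℂ :=
  c * (qpow κ (-((j : ℝ) / 2 * ((j : ℝ) / 2 + 1))) : ℂ) * epsVal κ j a

lemma formVal_eq (κ : ℝ) (c : ℂ) (j a : ℕ) :
    formVal κ c j a = c * (-1) ^ a * (qpow κ (-((a : ℝ) - (j : ℝ) / 2)) : ℂ) := by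
  have h := qpow_ofReal_ne_zero κ ((j : ℝ) / 2 * ((j : ℝ) / 2 + 1))
  rw [formVal, epsVal, qpow_neg κ (_ * _), Complex.ofReal_inv]
  generalize (qpow κ ((j : ℝ) / 2 * ((j : ℝ) / 2 + 1)) : ℂ) = x at h ⊢
  linear_combination (c * (-1) ^ a * (qpow κ (-((a : ℝ) - (j : ℝ) / 2)) : ℂ)) * inv_mul_cancel₀ h

lemma epsVal_mul_formVal (κ : ℝ) (c : ℂ) (J N x y : ℕ) :
    epsVal κ J x * formVal κ c N y = c * (qpow κ ((J : ℝ) / 2 * ((J : ℝ) / 2 + 1)) : ℂ)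
      * ((-1) ^ (x + y) * (qpow κ ((J : ℝ) / 2 - x + ((N : ℝ) / 2 - y)) : ℂ)) := by
  rw [formVal_eq, epsVal, qpow_add, neg_sub, neg_sub, pow_add]
  push_cast
  ring

/-- Invariance of the form under `u_J`, in coordinates. It holds separately for each `M` and each
magnetic number: `cg_swap` matches the Clebsch-Gordan coefficients, `lambda_swap` matches `Λ` up to
sign, and `hscal` balances that sign and the powers of `q`. -/
lemma twist_swap (κ : ℝ) (n : ℤ) (p : ℝ) (c : ℂ) {J N L : ℕ} (b : Fin (N + 1))
    (r r' : Fin (J + 1)) (a : Fin (L + 1)) :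
    twist κ n p J N L (b.rev, r) (r', a) * formVal κ c N b
      = (epsVal κ J r.rev)⁻¹ * epsVal κ J r'.rev
        * twist κ n p J L N (a.rev, r'.rev) (r.rev, b) * formVal κ c L a.rev := by
  rw [twist_apply, twist_apply, add_right_comm J N L, Finset.sum_mul, Finset.mul_sum,
    Finset.sum_mul]
  refine Finset.sum_congr rfl fun M _ => ?_
  -- One of the two sums is reindexed by `m ↦ -m`, as `cg_swap` reverses the magnetic number of the
  -- coupled spin too.
  rw [Finset.sum_mul, Finset.mul_sum, Finset.sum_mul, ← Equiv.sum_comp Fin.revPerm]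
  refine Finset.sum_congr rfl fun m _ => ?_
  have e1 : cg κ L J M (a.rev : ℕ) (r'.rev : ℕ) m = cg κ J L M r' a (m.rev : ℕ) := by
    rw [← cg_swap κ J L M (a := r') (b := a) (c := m.rev) (by omega) (by omega) (by omega)]
    simp only [Fin.val_rev]
    congr 1 <;> omega
  have e2 : cg κ J N M (r.rev : ℕ) b m = cg κ N J M b.rev r (m.rev : ℕ) := by
    rw [← cg_swap κ N J M (a := b.rev) (b := r) (c := m.rev) (by omega) (by omega) (by omega)]
    simp only [Fin.val_rev]
    congr 1 <;> omega
  rw [e1, e2, Fin.revPerm_apply]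
  by_cases h1 : cg κ N J M b.rev r m.rev = 0
  · rw [h1]; simp
  by_cases h2 : cg κ J L M r' a m.rev = 0
  · rw [h2]; simp
  obtain ⟨s, hs⟩ := exists_triangle_of_cg_ne_zero h1
  obtain ⟨t, ht⟩ := exists_triangle_of_cg_ne_zero h2
  have w1 := (cg_ne_zero_imp h1).2.2.2
  have w2 := (cg_ne_zero_imp h2).2.2.2
  have hl := lambda_swap κ n p J M N L
  have hb := b.is_lt
  have ha := a.is_lt
  have hr := r.is_lt
  have hr' := r'.is_lt
  have hbr : (b.rev : ℕ) = N - b := by rw [Fin.val_rev]; omega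
  have har : (a.rev : ℕ) = L - a := by rw [Fin.val_rev]; omega
  have hrr : (r.rev : ℕ) = J - r := by rw [Fin.val_rev]; omega
  have hrr' : (r'.rev : ℕ) = J - r' := by rw [Fin.val_rev]; omega
  rw [hbr] at w1
  -- Both coefficients are nonzero with the same `m`, so `w1` and `w2` equate the total magnetic
  -- numbers of the two pairs. This yields equal powers of `q` and, with the triangle parities,
  -- equal signs.
  have hscal : (-1) ^ ((N + J - M) / 2) * (epsVal κ J r.rev * formVal κ c N b)
      = (-1) ^ ((L + J - M) / 2) * (epsVal κ J r'.rev * formVal κ c L a.rev) := by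
    rw [epsVal_mul_formVal, epsVal_mul_formVal, hrr, hrr', har, Nat.cast_sub (by omega),
      Nat.cast_sub (by omega), Nat.cast_sub (by omega), mul_left_comm,
      mul_left_comm ((-1) ^ ((L + J - M) / 2))]
    congr 1
    rw [← mul_assoc, ← mul_assoc, ← pow_add, ← pow_add]
    congr 1
    · exact neg_one_pow_congr_mod (by omega)
    · congr 2
      have : (2 * ((N : ℝ) - (b : ℕ)) + 2 * (r : ℕ) + L) = 2 * (r' : ℕ) + 2 * (a : ℕ) + N := by
        rw [← Nat.cast_sub (by omega)]
        exact_mod_cast (by omega : 2 * (N - b) + 2 * (r : ℕ) + L = 2 * r' + 2 * a + N)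
      linarith
  have he := epsVal_ne_zero κ J r.rev
  generalize epsVal κ J r.rev = x at *
  generalize epsVal κ J r'.rev = x' at *
  have hσ : ((-1 : ℂ) ^ ((N + J - M) / 2)) ≠ 0 := pow_ne_zero _ (by norm_num)
  have hτ : ((-1 : ℂ) ^ ((L + J - M) / 2)) ≠ 0 := pow_ne_zero _ (by norm_num)
  generalize (-1 : ℂ) ^ ((N + J - M) / 2) = σ at *
  generalize (-1 : ℂ) ^ ((L + J - M) / 2) = τ at *
  have key : x * formVal κ c N b * lambda κ n p J M N L
      = x' * formVal κ c L a.rev * lambda κ n p J M L N := by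
    apply mul_left_cancel₀ (mul_ne_zero hσ hτ)
    linear_combination (σ * x * formVal κ c N b) * hl + (σ * lambda κ n p J M L N) * hscal
  apply mul_left_cancel₀ he
  rw [mul_assoc (x⁻¹ * x'), mul_assoc x⁻¹, mul_inv_cancel_left₀ he]
  push_cast
  linear_combination ((cg κ N J M b.rev r m.rev : ℂ) * (cg κ J L M r' a m.rev : ℂ)) * key

/-! ### The invariant form -/

lemma formVal_ne_zero (κ : ℝ) {c : ℂ} (hc : c ≠ 0) (j a : ℕ) : formVal κ c j a ≠ 0 :=
  mul_ne_zero (mul_ne_zero hc (qpow_ofReal_ne_zero _ _)) (epsVal_ne_zero _ _ _)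

/-- The intertwiner `φ^α : V_α → V_α^*`. -/
def phi (κ : ℝ) (n : ℤ) (c : ℂ) : V n →ₗ[ℂ] dualV n :=
  Finsupp.linearCombination ℂ fun x : VIdx n =>
    ⟨formVal κ c (n.natAbs + 2 * x.1) x.2.rev • Finsupp.lapply ⟨x.1, x.2.rev⟩,
      (dualV n).smul_mem _ (Submodule.subset_span ⟨_, rfl⟩)⟩

/-- The intertwiner `φ^α` with values in the algebraic dual. -/
def phiDual (κ : ℝ) (n : ℤ) (c : ℂ) : V n →ₗ[ℂ] Module.Dual ℂ (V n) :=
  (dualV n).subtype ∘ₗ phi κ n c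

lemma phiDual_e (κ : ℝ) (n : ℤ) (c : ℂ) (k : ℕ) (a : Fin (n.natAbs + 2 * k + 1)) (v : V n) :
    phiDual κ n c (e ⟨k, a⟩) v = formVal κ c (n.natAbs + 2 * k) a.rev * v ⟨k, a.rev⟩ := by
  simp [phiDual, phi, e]

lemma e_apply {n : ℤ} (x y : VIdx n) : (e x : V n) y = if x = y then 1 else 0 :=
  Finsupp.single_apply

lemma phiDual_apply_e (κ : ℝ) (n : ℤ) (c : ℂ) (k : ℕ) (b : Fin (n.natAbs + 2 * k + 1)) (w : V n) :
    phiDual κ n c w (e ⟨k, b⟩) = formVal κ c (n.natAbs + 2 * k) b * w ⟨k, b.rev⟩ := by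
  have h : (phiDual κ n c).flip (e ⟨k, b⟩)
      = formVal κ c (n.natAbs + 2 * k) b • Finsupp.lapply ⟨k, b.rev⟩ := by
    refine V_ext fun l a => ?_
    rw [LinearMap.flip_apply, phiDual_e, LinearMap.smul_apply, Finsupp.lapply_apply, e_apply,
      e_apply, smul_eq_mul]
    by_cases h : l = k
    · subst h
      by_cases h : b = a.rev
      · subst h
        simp
      · have h' : a ≠ b.rev := fun h' => h (by rw [h', Fin.rev_rev])
        simp [h, h']
    · have h' : k ≠ l := Ne.symm h
      simp [h, h']
  exact LinearMap.congr_fun h w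

/-- Each basis vector goes to a nonzero multiple of the dual vector of opposite magnetic number. -/
lemma phi_bijective (κ : ℝ) (n : ℤ) {c : ℂ} (hc : c ≠ 0) : Function.Bijective (phi κ n c) := by
  refine ⟨(injective_iff_map_eq_zero _).2 fun w hw => ?_, fun f => ?_⟩
  · ext ⟨k, a⟩
    have h := phiDual_apply_e κ n c k a.rev w
    rw [phiDual, LinearMap.comp_apply, hw, map_zero, LinearMap.zero_apply, Fin.rev_rev] at h
    exact (mul_eq_zero.1 h.symm).resolve_left (formVal_ne_zero κ hc _ _)
  · have h : dualV n ≤ LinearMap.range (phiDual κ n c) := by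
      refine Submodule.span_le.2 ?_
      rintro _ ⟨⟨k, a⟩, rfl⟩
      refine ⟨(formVal κ c (n.natAbs + 2 * k) a)⁻¹ • e ⟨k, a.rev⟩, LinearMap.ext fun v => ?_⟩
      rw [map_smul, LinearMap.smul_apply, phiDual_e, Fin.rev_rev, smul_eq_mul,
        inv_mul_cancel_left₀ (formVal_ne_zero κ hc _ _), Finsupp.lapply_apply]
    obtain ⟨w, hw⟩ := h f.2
    exact ⟨w, Subtype.ext hw⟩

lemma phiDual_e_e (κ : ℝ) (n : ℤ) (c : ℂ) (x y : VIdx n) :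
    phiDual κ n c (e x) (e y) = phiEntry κ n c x y := by
  obtain ⟨k, a⟩ := x
  obtain ⟨l, b⟩ := y
  rw [phiDual_e, e_apply, phiEntry]
  by_cases h : l = k
  · subst h
    simp only [dite_true, Fin.cast_refl, id_eq, eps_apply]
    by_cases h : b = a.rev
    · subst h
      simp [formVal]
    · simp [h]
  · simp [h]

lemma sum_smul_e_apply {n : ℤ} (k : ℕ) (f : Fin (n.natAbs + 2 * k + 1) → ℂ)
    (d : Fin (n.natAbs + 2 * k + 1)) : (∑ b, f b • e (⟨k, b⟩ : VIdx n)) ⟨k, d⟩ = f d := by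
  simp [Finsupp.finsetSum_apply, e_apply]

lemma sum_smul_e_apply_of_ne {n : ℤ} {k l : ℕ} (h : k ≠ l) (f : Fin (n.natAbs + 2 * k + 1) → ℂ)
    (d : Fin (n.natAbs + 2 * l + 1)) : (∑ b, f b • e (⟨k, b⟩ : VIdx n)) ⟨l, d⟩ = 0 := by
  simp [Finsupp.finsetSum_apply, e_apply, h]

/-- The action preserves each `V_I`, where the form is a scalar multiple of `ε`; `eps_mul_rep` then
applies block by block. -/
lemma phiDual_actUq (κ : ℝ) (n : ℤ) (c : ℂ) (x : Uq κ) (w v : V n) :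
    phiDual κ n c (actUq κ n x w) v = phiDual κ n c w (actUq κ n (Uq.antipode κ x) v) := by
  have h : phiDual κ n c ∘ₗ actUq κ n x
      = (phiDual κ n c).compl₂ (actUq κ n (Uq.antipode κ x)) := by
    refine V_ext fun k a => V_ext fun l b => ?_
    rw [LinearMap.comp_apply, LinearMap.compl₂_apply, phiDual_apply_e, phiDual_e, actUq_e, actUq_e]
    by_cases h : k = l
    · subst h
      rw [sum_smul_e_apply, sum_smul_e_apply]
      have h := congrFun (congrFun (eps_mul_rep κ (n.natAbs + 2 * k) x) b) a
      rw [eps_mul_apply, mul_eps_apply, Matrix.transpose_apply] at h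
      rw [formVal, formVal, mul_assoc, h]
      ring
    · rw [sum_smul_e_apply_of_ne h, sum_smul_e_apply_of_ne (Ne.symm h), mul_zero, mul_zero]
  exact LinearMap.congr_fun₂ h w v

lemma actFq_u_e_apply (κ : ℝ) (n : ℤ) (p : ℝ) (J : ℕ) (r r' : Fin (J + 1)) (k l : ℕ)
    (a : Fin (n.natAbs + 2 * k + 1)) (d : Fin (n.natAbs + 2 * l + 1)) :
    actFq κ n p (Fq.u J r r') (e ⟨k, a⟩) ⟨l, d⟩
      = twist κ n p J (n.natAbs + 2 * l) (n.natAbs + 2 * k) (d, r) (r', a) := by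
  rw [actFq_u_e, Finsupp.finsetSum_apply]
  by_cases h : l ∈ Finset.range (k + J + 1)
  · rw [Finset.sum_eq_single_of_mem l h fun k' _ hk => sum_smul_e_apply_of_ne hk _ _,
      sum_smul_e_apply]
  · rw [Finset.mem_range] at h
    rw [twist_eq_zero κ n p (by omega), Finset.sum_eq_zero]
    intro k' hk
    rw [Finset.mem_range] at hk
    exact sum_smul_e_apply_of_ne (by omega) _ _

lemma phiDual_actFq (κ : ℝ) (n : ℤ) (p : ℝ) (c : ℂ) (f : Fq) (w v : V n) :
    phiDual κ n c (actFq κ n p f w) v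
      = phiDual κ n c w (actFq κ n p (Fq.antipodeInv κ f) v) := by
  have hu : ∀ (J : ℕ) (r r' : Fin (J + 1)), phiDual κ n c ∘ₗ actFq κ n p (Fq.u J r r')
      = (phiDual κ n c).compl₂ (actFq κ n p (Fq.antipodeInv κ (Fq.u J r r'))) := by
    intro J r r'
    refine V_ext fun k a => V_ext fun l b => ?_
    rw [LinearMap.comp_apply, LinearMap.compl₂_apply, phiDual_apply_e, phiDual_e, antipodeInv_u,
      map_smul, LinearMap.smul_apply, Finsupp.smul_apply, actFq_u_e_apply, actFq_u_e_apply,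
      smul_eq_mul, mul_comm, twist_swap, mul_comm]
  have h : LinearMap.applyₗ v ∘ₗ phiDual κ n c ∘ₗ LinearMap.applyₗ w ∘ₗ actFq κ n p
      = phiDual κ n c w ∘ₗ LinearMap.applyₗ v ∘ₗ actFq κ n p ∘ₗ Fq.antipodeInv κ :=
    Fq.basis.ext fun ⟨J, r, r'⟩ => LinearMap.congr_fun₂ (hu J r r') w v
  exact LinearMap.congr_fun h f

/-- For `a = x f` the factors are moved across the form one after the other, `x` first, which
produces the order `S(f) S(x)`. -/
lemma phiDual_principal {κ : ℝ} (hκ : 0 < κ) (n : ℤ) (p : ℝ) (c : ℂ) (a : QLG κ) (w v : V n) :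
    phiDual κ n c (principal κ n p a w) v
      = phiDual κ n c w (principal κ n p (QLG.antipode κ a) v) := by
  induction a using TensorProduct.induction_on with
  | zero => simp
  | add a b ha hb => simp only [map_add, LinearMap.add_apply, ha, hb]
  | tmul x f =>
    rw [principal_antipode_tmul hκ, principal_tmul, Module.End.mul_apply, Module.End.mul_apply,
      phiDual_actUq, phiDual_actFq]

end QLorentz

end

theorem mainTheorem4 (κ : ℝ) (hκ : 0 < κ) (n : ℤ) (p : ℝ) (hα : QLorentz.IsPrincipal κ n p)
    (c : ℂ) (hc : c ≠ 0) :
    ∃ φ : QLorentz.V n →ₗ[ℂ] QLorentz.dualV n,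
      Function.Bijective φ ∧
      (∀ (a : QLorentz.QLG κ) (w : QLorentz.V n),
        (φ (QLorentz.principal κ n p a w) : Module.Dual ℂ (QLorentz.V n)) =
          (φ w : Module.Dual ℂ (QLorentz.V n)) ∘ₗ
            QLorentz.principal κ n p (QLorentz.QLG.antipode κ a)) ∧
      (∀ x y : QLorentz.VIdx n,
        (φ (QLorentz.e x) : Module.Dual ℂ (QLorentz.V n)) (QLorentz.e y) =
          QLorentz.phiEntry κ n c x y) ∧
      (∀ (a : QLorentz.QLG κ) (v w : QLorentz.V n),
        QLorentz.beta φ v (QLorentz.principal κ n p a w) =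
          QLorentz.beta φ (QLorentz.principal κ n p (QLorentz.QLG.antipode κ a) v) w) :=
  -- Since `β_α(v, w) = φ^α(w)(v)`, the second and fourth claims are the same identity.
  ⟨QLorentz.phi κ n c, QLorentz.phi_bijective κ n hc,
    fun a w => LinearMap.ext fun v => QLorentz.phiDual_principal hκ n p c a w v,
    QLorentz.phiDual_e_e κ n c, fun a v w => QLorentz.phiDual_principal hκ n p c a w v⟩
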